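/- Let $p$ be $0$ or a prime and let $\mathbf{k}$ be a field of characteristic $p$. *Matroids.* Let $F$ be any field of characteristic $p$. Vectors $v_1,\dots,v_n\in F^r$ are *totally generic* if their $nr$ coordinates are algebraically independent over the prime field of $F$. For totally generic $v_1,\dots,v_n\in F^r$, the symmetric power matroid $\mathrm{S}_n(r,p)$ is the matroid on $\{(i,j): 1\le i\le j\le n\}$ represented by the vectors $v_iv_j\in\operatorname{Sym}^2F^r$, and the wedge power matroid $\mathrm{W}_n(r,p)$ is the matroid on $\{(i,j): 1\le i<j\le n\}$ represented by the vectors $v_i\wedge v_j\in\wedge^2F^r$. For $u_1,\dots,u_m\in F^s$ and $v_1,\dots,v_n\in F^r$ whose $ms+nr$ coordinates are together algebraically independent over the prime field, the tensor matroid $\mathrm{T}_{m,n}(s,r,p)$ is the matroid on $[m]\times[n]$ represented by the vectors $u_i\otimes v_j\in F^s\otimes F^r$. (The statements below hold for every choice of $F$ and of such vectors.) *Varieties.* For a set $Y$ of $m\times n$ matrices over an algebraic closure $\overline{\mathbf{k}}$, let $I(Y)\subseteq\mathbf{k}[x_{ij}]$ be the ideal of polynomials vanishing on $Y$. If $I(Y)$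 is prime, the function field of $Y$ over $\mathbf{k}$ is $K(Y)=\operatorname{Frac}(\mathbf{k}[x_{ij}]/I(Y))$, and the coordinate functions on $Y$ are the images of the $x_{ij}$ in $K(Y)$. A matrix is called skew-symmetric if $A^t=-A$ and its diagonal is zero. *Separable independence.* For a finitely generated field extension $K/L$, elements $a_1,\dots,a_\ell\in K$ are *separably algebraically independent* over $L$ if there are $b_1,\dots,b_q\in K$ such that $a_1,\dots,a_\ell,b_1,\dots,b_q$ are algebraically independent over $L$ and $K$ is a finite separable extension of $L(a_1,\dots,a_\ell,b_1,\dots,b_q)$. Then the following hold. 1. Suppose $p\ne2$ and $0\le d\le n$, and let $Y$ be the variety of symmetric $n\times n$ matrices of rank at most $d$. Then $I(Y)$ is prime, and a set $S\subseteq\{(i,j): i\le j\}$ is independent in the dual of $\mathrm{S}_n(n-d,p)$ if and only if the coordinate functions $(x_{ij})_{(i,j)\in S}$ in $K(Y)$ are separably algebraically independent over $\mathbf{k}$. 2. Suppose $0\le 2d\le n$, and let $Y$ be the variety of skew-symmetric $n\times n$ matrices of rank at most $2d$. Then $I(Y)$ is prime, and a set $S\subseteq\{(i,j): i<j\}$ is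 independent in the dual of $\mathrm{W}_n(n-2d,p)$ if and only if the coordinate functions $(x_{ij})_{(i,j)\in S}$ in $K(Y)$ are separably algebraically independent over $\mathbf{k}$. 3. Suppose $0\le d\le\min(m,n)$, and let $Y$ be the variety of $m\times n$ matrices of rank at most $d$. Then $I(Y)$ is prime, and a set $S\subseteq[m]\times[n]$ is independent in the dual of $\mathrm{T}_{m,n}(m-d,n-d,p)$ if and only if the coordinate functions $(x_{ij})_{(i,j)\in S}$ in $K(Y)$ are separably algebraically independent over $\mathbf{k}$. -/

import Mathlib

open scoped TensorProduct

namespace LowRank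

/-! ### Matroids represented by finite families of vectors -/

/-- The augmentation axiom for linearly independent subfamilies of a finite family. -/
theorem linearIndepOn_augment {F V α : Type*} [Field F] [AddCommGroup V] [Module F V] [Finite α]
    (v : α → V) {I J : Set α} (hI : LinearIndepOn F v I) (hJ : LinearIndepOn F v J)
    (hlt : I.ncard < J.ncard) : ∃ e ∈ J, e ∉ I ∧ LinearIndepOn F v (insert e I) := by
  classical
  by_contra! hcon
  have hmem : ∀ e ∈ J, v e ∈ Submodule.span F (v '' I) := by
    intro e he
    by_cases heI : e ∈ I
    · exact Submodule.subset_span ⟨e, heI, rfl⟩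
    · by_contra hne
      exact hcon e he heI ((linearIndepOn_insert heI).2 ⟨hI, hne⟩)
  have hle : Submodule.span F (v '' J) ≤ Submodule.span F (v '' I) := by
    rw [Submodule.span_le]
    rintro _ ⟨e, he, rfl⟩
    exact hmem e he
  have hcard : ∀ X : Set α, LinearIndepOn F v X →
      Module.finrank F (Submodule.span F (v '' X)) = X.ncard := by
    intro X hX
    have := Fintype.ofFinite X
    have h := finrank_span_eq_card (R := F) (b := fun x : X => v x) hX
    rw [Set.image_eq_range, h, ← Nat.card_eq_fintype_card, Nat.card_coe_set_eq]
  have : Module.Finite F (Submodule.span F (v '' I)) :=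
    FiniteDimensional.span_of_finite F (Set.toFinite _)
  have := Submodule.finrank_mono hle
  rw [hcard I hI, hcard J hJ] at this
  omega

/-- The matroid represented by a finite family of vectors: its ground set is the whole index type,
and a set of indices is independent when the corresponding subfamily is linearly independent. -/
noncomputable def representedMatroid (F : Type*) {V α : Type*} [Field F] [AddCommGroup V]
    [Module F V] [Finite α] (v : α → V) : Matroid α :=
  (IndepMatroid.ofFinite (E := Set.univ) Set.finite_univ (fun I => LinearIndepOn F v I)
    (linearIndepOn_empty F v) (fun _ _ hJ hIJ => hJ.mono hIJ)
    (fun _ _ hI hJ hlt => linearIndepOn_augment v hI hJ hlt)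
    (fun _ _ => Set.subset_univ _)).matroid

/-! ### Symmetric power, wedge power and tensor matroids -/

/-- The set `binom([n], 2) ⊔ [n]`, encoded as the pairs `i ≤ j`. -/
abbrev SymIndex (n : ℕ) : Type := {e : Fin n × Fin n // e.1 ≤ e.2}

/-- The set `binom([n], 2)`, encoded as the pairs `i < j`. -/
abbrev SkewIndex (n : ℕ) : Type := {e : Fin n × Fin n // e.1 < e.2}

/-- A family of scalars of `F` is generic when it is algebraically independent over the prime
field of `F`. -/
def GenericScalars {F ι : Type*} [Field F] (c : ι → F) : Prop :=
  AlgebraicIndependent (⊥ : Subfield F) c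

/-- Vectors `v₁, …, vₙ` of `F ^ r` are totally generic when their `n * r` coordinates are
algebraically independent over the prime field. -/
def TotallyGeneric {F : Type*} [Field F] {n r : ℕ} (v : Fin n → Fin r → F) : Prop :=
  GenericScalars fun e : Fin n × Fin r => v e.1 e.2

/-- Vectors `u₁, …, uₘ` of `F ^ s` and `v₁, …, vₙ` of `F ^ r` are jointly totally generic when all
their `m * s + n * r` coordinates together are algebraically independent over the prime field. -/
def JointlyTotallyGeneric {F : Type*} [Field F] {m n s r : ℕ}
    (u : Fin m → Fin s → F) (v : Fin n → Fin r → F) : Prop :=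
  GenericScalars (Sum.elim (fun e : Fin m × Fin s => u e.1 e.2)
    (fun e : Fin n × Fin r => v e.1 e.2))

/-- The matroid represented by the products `vᵢ vⱼ`, `i ≤ j`, in `Sym² (F ^ r)`, the degree-two
part of the symmetric algebra of `F ^ r`. For totally generic `v` over a field of characteristic
`p` this is the symmetric power matroid `S_n(r, p)`. -/
noncomputable def symmetricPowerMatroid {F : Type*} [Field F] {n r : ℕ} (v : Fin n → Fin r → F) :
    Matroid (SymIndex n) :=
  representedMatroid F fun e : SymIndex n =>
    SymmetricAlgebra.ι F (Fin r → F) (v e.1.1) * SymmetricAlgebra.ι F (Fin r → F) (v e.1.2)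

/-- The matroid represented by the products `vᵢ ∧ vⱼ`, `i < j`, in `⋀² (F ^ r)`. For totally
generic `v` over a field of characteristic `p` this is the wedge power matroid `W_n(r, p)`. -/
noncomputable def wedgePowerMatroid {F : Type*} [Field F] {n r : ℕ} (v : Fin n → Fin r → F) :
    Matroid (SkewIndex n) :=
  representedMatroid F fun e : SkewIndex n => exteriorPower.ιMulti F 2 ![v e.1.1, v e.1.2]

/-- The matroid represented by the tensors `uᵢ ⊗ vⱼ` in `F ^ s ⊗ F ^ r`. For jointly totally
generic `u`, `v` over a field of characteristic `p` this is the tensor matroid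
`T_{m,n}(s, r, p)`. -/
noncomputable def tensorMatroid {F : Type*} [Field F] {m n s r : ℕ}
    (u : Fin m → Fin s → F) (v : Fin n → Fin r → F) : Matroid (Fin m × Fin n) :=
  representedMatroid F fun e : Fin m × Fin n => u e.1 ⊗ₜ[F] v e.2

/-! ### Varieties of matrices and their function fields -/

/-- The `m × n` matrices of rank at most `d`. -/
def rankLocus (R : Type*) [Field R] (m n d : ℕ) : Set (Matrix (Fin m) (Fin n) R) :=
  {A | A.rank ≤ d}

/-- The symmetric `n × n` matrices of rank at most `d`. -/
def symRankLocus (R : Type*) [Field R] (n d : ℕ) : Set (Matrix (Fin n) (Fin n) R) :=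
  {A | A.IsSymm ∧ A.rank ≤ d}

/-- The skew-symmetric `n × n` matrices of rank at most `d`. The diagonal is required to vanish,
which is automatic outside characteristic two. -/
def skewRankLocus (R : Type*) [Field R] (n d : ℕ) : Set (Matrix (Fin n) (Fin n) R) :=
  {A | A.transpose = -A ∧ (∀ i, A i i = 0) ∧ A.rank ≤ d}

/-- The ideal over `k` of a set `Y` of matrices with entries in the algebraic closure of `k`: the
polynomials over `k` in the matrix entries that vanish on `Y`. -/
noncomputable def matrixIdeal (k : Type*) [Field k] {m n : ℕ}
    (Y : Set (Matrix (Fin m) (Fin n) (AlgebraicClosure k))) :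
    Ideal (MvPolynomial (Fin m × Fin n) k) :=
  MvPolynomial.vanishingIdeal k ((fun A (e : Fin m × Fin n) => A e.1 e.2) '' Y)

/-- The ring of regular functions, over `k`, on a variety of matrices. -/
abbrev CoordinateRing (k : Type*) [Field k] {m n : ℕ}
    (Y : Set (Matrix (Fin m) (Fin n) (AlgebraicClosure k))) : Type _ :=
  MvPolynomial (Fin m × Fin n) k ⧸ matrixIdeal k Y

/-- The ring of rational functions, over `k`, on a variety of matrices. It is a field when the
ideal of the variety is prime. -/
abbrev FunctionField (k : Type*) [Field k] {m n : ℕ}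
    (Y : Set (Matrix (Fin m) (Fin n) (AlgebraicClosure k))) : Type _ :=
  FractionRing (CoordinateRing k Y)

/-- The coordinate function `A ↦ A i j`, as a rational function on a variety of matrices. -/
noncomputable def coordinateFunction (k : Type*) [Field k] {m n : ℕ}
    (Y : Set (Matrix (Fin m) (Fin n) (AlgebraicClosure k))) (e : Fin m × Fin n) :
    FunctionField k Y :=
  algebraMap (CoordinateRing k Y) (FunctionField k Y)
    (Ideal.Quotient.mk (matrixIdeal k Y) (MvPolynomial.X e))

/-! ### Separable algebraic independence -/

/-- A separating transcendence basis of `K / L`: an algebraically independent family such that `K`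
is a finite separable extension of the subfield it generates over `L`. -/
def IsSeparatingTranscendenceBasis (L : Type*) {K ι : Type*} [Field L] [Field K] [Algebra L K]
    (c : ι → K) : Prop :=
  AlgebraicIndependent L c ∧
    FiniteDimensional (IntermediateField.adjoin L (Set.range c)) K ∧
    Algebra.IsSeparable (IntermediateField.adjoin L (Set.range c)) K

/-- A family is separably algebraically independent when it can be extended by finitely many
elements to a separating transcendence basis. -/
def SeparablyAlgebraicallyIndependent (L : Type*) {K ι : Type*} [Field L] [Field K] [Algebra L K]
    (a : ι → K) : Prop :=
  ∃ (q : ℕ) (b : Fin q → K), IsSeparatingTranscendenceBasis L (Sum.elim a b)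

end LowRank

set_option linter.unusedSectionVars false

namespace LowRank


/-! ### Differentials and separable algebraic independence -/

section Differentials

variable {k L : Type*} [Field k] [Field L] [Algebra k L]

/-! Both sides of each equivalence say that no nonzero matrix of a certain shape is supported on
`S`.

Matroid side. `S` is independent in the dual exactly when the vectors outside `S` span everything,
that is, when a functional vanishing on them vanishes on all the vectors. A functional on the tensor
product, symmetric square or exterior square is an arbitrary, symmetric or alternating matrix `B`,
and its values on the given vectors are the entries of `U * B * Vᵀ`, with `U = V` in the last two
cases (`representedMatroid_dual_indep_iff` and its three specializations). The symmetric case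
requires dividing by two.

Variety side. A general matrix of rank `d` is uniquely `frame P * C * (frame Q)ᵀ`, where `frame P`
is an identity block on top of `P`. This chart is dense and birational, so `I(Y)` is the kernel of a
homomorphism to a polynomial ring, hence prime, and the function field is purely transcendental over
`k`. There the dimension of the Kähler differentials equals the transcendence degree, and so
separable algebraic independence is linear independence of differentials
(`separablyAlgebraicallyIndependent_iff_linearIndependent_D`). Dually, no nonzero coefficient vector
supported on `S` annihilates the tangent space at the generic point. The annihilator of that space,
the conormal space, consists of the matrices `coframe P * B * (coframe Q)ᵀ`
(`forall_trace_tangent_eq_zero_iff_and`, `eq_coframe_mul_mul_coframe`).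

Comparison. It remains to replace totally generic `U`, `V` over `F` by generic coframes over the
function field. Column operations turn `U` into a coframe and are absorbed in `B`. Injectivity of `B
↦ U * B * Vᵀ` off `S` is the nonvanishing of some minor with integer polynomial entries, so it
passes from any point to a generic point of the same characteristic, even over an unrelated field
(`aeval_int_eq_zero_of_algebraicIndependent`).

Symmetric and alternating matrices are handled together through a sign `b`. The rank is even in the
alternating case because the middle factor `C` must be generically invertible. -/

theorem D_mem_span_of_mem_adjoin {s : Set L} {x : L} (hx : x ∈ IntermediateField.adjoin k s) :
    KaehlerDifferential.D k L x ∈ Submodule.span L (KaehlerDifferential.D k L '' s) := by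
  induction hx using IntermediateField.adjoin_induction with
  | mem x hx => exact Submodule.subset_span ⟨x, hx, rfl⟩
  | algebraMap x => simp
  | add x y _ _ hx hy => rw [map_add]; exact add_mem hx hy
  | inv x _ hx => rw [Derivation.leibniz_inv]; exact Submodule.smul_mem _ _ hx
  | mul x y _ _ hx hy =>
    rw [Derivation.leibniz]
    exact add_mem (Submodule.smul_mem _ _ hy) (Submodule.smul_mem _ _ hx)

/-- The map from the differentials over `k` to those over `k(s)` is surjective, and its kernel is
spanned by the differentials of elements of `k(s)`. By the sum, product and inverse rules these lie
in the span of the differentials of `s`. -/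
theorem span_D_eq_top_iff_formallyUnramified (s : Set L) :
    Submodule.span L (KaehlerDifferential.D k L '' s) = ⊤ ↔
      Algebra.FormallyUnramified (IntermediateField.adjoin k s) L := by
  rw [Algebra.formallyUnramified_iff]
  constructor
  · intro h
    refine subsingleton_of_forall_eq 0 fun y => ?_
    obtain ⟨z, rfl⟩ := KaehlerDifferential.map_surjective k (IntermediateField.adjoin k s) L y
    have hz : z ∈ Submodule.span L (KaehlerDifferential.D k L '' s) := h ▸ Submodule.mem_top
    suffices Submodule.span L (KaehlerDifferential.D k L '' s) ≤
        LinearMap.ker (KaehlerDifferential.map k (IntermediateField.adjoin k s) L L) from this hz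
    rw [Submodule.span_le]
    rintro _ ⟨x, hx, rfl⟩
    rw [SetLike.mem_coe, LinearMap.mem_ker, KaehlerDifferential.map_D]
    exact (KaehlerDifferential.D (IntermediateField.adjoin k s) L).map_algebraMap
      ⟨x, IntermediateField.subset_adjoin k s hx⟩
  · intro h
    have hr := KaehlerDifferential.range_mapBaseChange k (IntermediateField.adjoin k s) L
    rw [LinearMap.ker_eq_top.2 (Subsingleton.elim _ _)] at hr
    rw [eq_top_iff, ← hr]
    rintro _ ⟨z, rfl⟩
    induction z with
    | zero => simp
    | add x y hx hy => rw [map_add]; exact add_mem hx hy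
    | tmul x y =>
      rw [KaehlerDifferential.mapBaseChange_tmul]
      refine Submodule.smul_mem _ _ ?_
      obtain ⟨y, rfl⟩ := KaehlerDifferential.linearCombination_surjective _ _ y
      induction y using Finsupp.induction_linear with
      | zero => simp
      | add x y hx hy => rw [map_add, map_add]; exact add_mem hx hy
      | single a b =>
        rw [Finsupp.linearCombination_single, map_smul, KaehlerDifferential.map_D,
          ← algebraMap_smul L]
        exact Submodule.smul_mem _ _ (D_mem_span_of_mem_adjoin a.2)

/-- A family with as many members as the transcendence degree is a separating transcendence basis
exactly when its differentials span. -/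
theorem isSeparatingTranscendenceBasis_iff_span {ι : Type*} [Finite ι] [Algebra.EssFiniteType k L]
    (c : ι → L) (hc : (Nat.card ι : Cardinal) = Algebra.trdeg k L) :
    IsSeparatingTranscendenceBasis k c ↔
      Submodule.span L (Set.range fun i => KaehlerDifferential.D k L (c i)) = ⊤ := by
  have hrange : (Set.range fun i => KaehlerDifferential.D k L (c i)) =
      KaehlerDifferential.D k L '' Set.range c := by
    rw [← Set.range_comp]; rfl
  have : Algebra.EssFiniteType (IntermediateField.adjoin k (Set.range c)) L :=
    Algebra.EssFiniteType.of_comp k _ L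
  rw [hrange, span_D_eq_top_iff_formallyUnramified]
  constructor
  · rintro ⟨-, -, h⟩
    exact Algebra.FormallyUnramified.of_isSeparable _ _
  · intro h
    -- An unramified extension of fields that is essentially of finite type is finite and separable.
    -- So `L` is algebraic over the field generated by `c`, and a family of this kind with only
    -- transcendence-degree many members is algebraically independent.
    have hfin := Algebra.FormallyUnramified.finite_of_free
      (R := IntermediateField.adjoin k (Set.range c)) (S := L)
    refine ⟨?_, hfin, Algebra.FormallyUnramified.isSeparable _ _⟩
    have halg : Algebra.IsAlgebraic (IntermediateField.adjoin k (Set.range c)) L :=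
      Algebra.IsAlgebraic.of_finite _ _
    have halg' : Algebra.IsAlgebraic (Algebra.adjoin k (Set.range c)) L :=
      IntermediateField.isAlgebraic_adjoin_iff_top.mp halg
    refine (Algebra.IsAlgebraic.isTranscendenceBasis_of_lift_le_trdeg_of_finite k c ?_).1
    rw [← hc, Cardinal.lift_natCast, ← Nat.cast_card (α := ι), Cardinal.lift_natCast]

theorem card_eq_trdeg_of_isSeparatingTranscendenceBasis {ι : Type*} [Finite ι]
    {c : ι → L} (h : IsSeparatingTranscendenceBasis k c) :
    (Nat.card ι : Cardinal) = Algebra.trdeg k L := by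
  obtain ⟨h1, h2, -⟩ := h
  have halg : Algebra.IsAlgebraic (Algebra.adjoin k (Set.range c)) L :=
    IntermediateField.isAlgebraic_adjoin_iff_top.mp (Algebra.IsAlgebraic.of_finite _ _)
  have := (h1.isTranscendenceBasis_iff_isAlgebraic.2 halg).lift_cardinalMk_eq_trdeg
  rw [← Nat.cast_card (α := ι), Cardinal.lift_natCast] at this
  exact Cardinal.lift_injective (by rw [← this, Cardinal.lift_natCast])

/-- The differentials of a separating transcendence basis span and are as many as the dimension, so
they are a basis. Conversely, independent differentials extend to a basis by differentials of
further elements of `L`, because all differentials together span. The hypothesis `hL` makes the size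
of this basis the transcendence degree. -/
theorem separablyAlgebraicallyIndependent_iff_linearIndependent_D {ι : Type*} [Finite ι]
    [Algebra.EssFiniteType k L]
    (hL : (Module.finrank L (Ω[L⁄k]) : Cardinal) = Algebra.trdeg k L) (a : ι → L) :
    SeparablyAlgebraicallyIndependent k a ↔
      LinearIndependent L fun i => KaehlerDifferential.D k L (a i) := by
  constructor
  · rintro ⟨q, b, h⟩
    have hcard := card_eq_trdeg_of_isSeparatingTranscendenceBasis h
    have hspan := (isSeparatingTranscendenceBasis_iff_span _ hcard).1 h
    have := Fintype.ofFinite (ι ⊕ Fin q)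
    have hli := linearIndependent_of_top_le_span_of_card_eq_finrank hspan.ge
      (by rw [← Nat.card_eq_fintype_card]; exact_mod_cast hcard.trans hL.symm)
    exact hli.comp Sum.inl Sum.inl_injective
  · intro h
    have hinj : Function.Injective a := fun i j hij => h.injective (by simp only [hij])
    have hon : LinearIndepOn L (KaehlerDifferential.D k L) (Set.range a) :=
      (linearIndepOn_range_iff hinj _).2 h
    have hext := hon.linearIndepOn_extend (Set.subset_univ _)
    have hsub := hon.subset_extend (Set.subset_univ _)
    have hspan := hon.span_image_extend_eq_span_image (Set.subset_univ _)
    set E := hon.extend (Set.subset_univ _)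
    have hEfin : Finite E := hext.finite
    obtain ⟨q, ⟨e⟩⟩ := Finite.exists_equiv_fin (E \ Set.range a : Set L)
    refine ⟨q, fun i => (e.symm i).1, ?_⟩
    have hrange : (Set.range fun i => KaehlerDifferential.D k L
        (Sum.elim a (fun i : Fin q => (e.symm i).1) i)) = KaehlerDifferential.D k L '' E := by
      have hr : Set.range (fun i : Fin q => (e.symm i).1) = E \ Set.range a := by
        rw [← Function.comp_def, e.symm.surjective.range_comp, Subtype.range_coe]
      rw [← Function.comp_def, Set.range_comp, Set.Sum.elim_range, hr, Set.union_sdiff_cancel hsub]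
    have htop : Submodule.span L (KaehlerDifferential.D k L '' E) = ⊤ := by
      rw [hspan, Set.image_univ, KaehlerDifferential.span_range_derivation]
    refine (isSeparatingTranscendenceBasis_iff_span _ ?_).2 (hrange ▸ htop)
    rw [← hL]
    have hcard : Module.finrank L (Ω[L⁄k]) = Nat.card E := by
      have := Fintype.ofFinite E
      rw [← finrank_top, ← htop, Set.image_eq_range, finrank_span_eq_card hext,
        Nat.card_eq_fintype_card]
    have hn : Nat.card (ι ⊕ Fin q) = Nat.card E := by
      rw [Nat.card_sum, ← Nat.card_congr e, Nat.card_congr (Equiv.ofInjective a hinj),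
        Nat.card_coe_set_eq, Nat.card_coe_set_eq, Nat.card_coe_set_eq, add_comm,
        Set.ncard_sdiff_add_ncard_of_subset hsub]
    rw [hcard, hn]

/-! ### Purely transcendental extensions -/

variable {T : Type*} [Algebra (MvPolynomial T k) L] 
  [IsScalarTower k (MvPolynomial T k) L] [IsFractionRing (MvPolynomial T k) L]

variable (k L T) in
theorem essFiniteType_of_isFractionRing_mvPolynomial [Finite T] : Algebra.EssFiniteType k L :=
  have : Algebra.EssFiniteType (MvPolynomial T k) L :=
    Algebra.EssFiniteType.of_isLocalization L (nonZeroDivisors (MvPolynomial T k))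
  Algebra.EssFiniteType.comp k (MvPolynomial T k) L

variable (k L T) in
/-- The differentials of the variables form a basis of the differentials of the field of rational
functions. -/
noncomputable def basisDifferentialsOfFractionRing : Module.Basis T L (Ω[L⁄k]) :=
  (KaehlerDifferential.mvPolynomialBasis k T).ofIsLocalizedModule L
    (nonZeroDivisors (MvPolynomial T k)) (KaehlerDifferential.map k k (MvPolynomial T k) L)

theorem basisDifferentialsOfFractionRing_repr (f : MvPolynomial T k) (t : T) :
    (basisDifferentialsOfFractionRing k L T).repr
      (KaehlerDifferential.D k L (algebraMap _ L f)) t =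
        algebraMap _ L (MvPolynomial.pderiv t f) := by
  rw [← KaehlerDifferential.map_D k k, basisDifferentialsOfFractionRing,
    Module.Basis.ofIsLocalizedModule_repr_apply, KaehlerDifferential.mvPolynomialBasis_repr_apply]

variable (k L T) in
theorem finrank_differentials_eq_trdeg [Finite T] :
    (Module.finrank L (Ω[L⁄k]) : Cardinal) = Algebra.trdeg k L := by
  have := Fintype.ofFinite T
  rw [Module.finrank_eq_card_basis (basisDifferentialsOfFractionRing k L T)]
  have halg : Algebra.IsAlgebraic (MvPolynomial T k) L :=
    IsLocalization.isAlgebraic L (nonZeroDivisors (MvPolynomial T k))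
  have hb :=
    ((IsTranscendenceBasis.mvPolynomial T k).algebraMap_comp (A := L)).lift_cardinalMk_eq_trdeg
  rw [Cardinal.mk_fintype, Cardinal.lift_natCast] at hb
  exact Cardinal.lift_injective (by rw [← hb, Cardinal.lift_natCast])

/-- A derivation of a polynomial ring in terms of the partial derivatives. -/
theorem mkDerivation_eq_sum_pderiv {k L T : Type*} [Field k] [Field L] [Algebra k L] [Fintype T]
    [Algebra (MvPolynomial T k) L] [IsScalarTower k (MvPolynomial T k) L]
    (w : T → L) (g : MvPolynomial T k) : MvPolynomial.mkDerivation k w g =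
      ∑ t, algebraMap _ L (MvPolynomial.pderiv t g) * w t := by
  induction g using MvPolynomial.induction_on with
  | C a => simp
  | add p q hp hq => simp only [map_add, hp, hq, add_mul, Finset.sum_add_distrib]
  | mul_X p i hp =>
    classical
    simp [Derivation.leibniz, hp, add_mul, Finset.sum_add_distrib, Pi.single_apply,
      Algebra.smul_def, Finset.mul_sum, mul_assoc, apply_ite (algebraMap (MvPolynomial T k) L)]

/-- The coordinates of a differential in the basis given by the variables are partial derivatives,
so a linear relation between differentials is one that holds after every derivation. The vector `w`
is a tangent direction in parameter space, which makes this the dual form needed for tangent spaces.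
-/
theorem separablyAlgebraicallyIndependent_algebraMap_iff {ι : Type*} [Finite T] [Fintype ι]
    (f : ι → MvPolynomial T k) :
    SeparablyAlgebraicallyIndependent k (fun i => algebraMap (MvPolynomial T k) L (f i)) ↔
      ∀ c : ι → L, (∀ w : T → L, ∑ i, c i * MvPolynomial.mkDerivation k w (f i) = 0) → c = 0 := by
  have := essFiniteType_of_isFractionRing_mvPolynomial k L T
  have := Fintype.ofFinite T
  rw [separablyAlgebraicallyIndependent_iff_linearIndependent_D
    (finrank_differentials_eq_trdeg k L T), Fintype.linearIndependent_iff]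
  refine forall_congr' fun c => ?_
  rw [funext_iff]
  refine imp_congr_left ?_
  rw [← (basisDifferentialsOfFractionRing k L T).repr.map_eq_zero_iff, Finsupp.ext_iff]
  simp only [map_sum, map_smul, Finsupp.coe_finsetSum, Finset.sum_apply, Finsupp.smul_apply,
    basisDifferentialsOfFractionRing_repr, smul_eq_mul, Finsupp.zero_apply,
    mkDerivation_eq_sum_pderiv, Finset.mul_sum]
  constructor
  · intro h w
    rw [Finset.sum_comm]
    refine Finset.sum_eq_zero fun t _ => ?_
    simp only [← mul_assoc, ← Finset.sum_mul, h, zero_mul]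
  · intro h t
    classical
    simpa [Pi.single_apply] using h (Pi.single t 1)

theorem separablyAlgebraicallyIndependent_iff_of_algEquiv {k L T ι : Type*} [Field k] [Field L]
    [Algebra k L] [Finite T] [Fintype ι] (E : FractionRing (MvPolynomial T k) ≃ₐ[k] L)
    (a : ι → L) (f : ι → MvPolynomial T k) (h : ∀ i, E (algebraMap _ _ (f i)) = a i) :
    SeparablyAlgebraicallyIndependent k a ↔
      ∀ c : ι → FractionRing (MvPolynomial T k), (∀ w : T → FractionRing (MvPolynomial T k),
        ∑ i, c i * MvPolynomial.mkDerivation k w (f i) = 0) → c = 0 := by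
  let alg : Algebra (MvPolynomial T k) L := (E.toRingHom.comp (algebraMap _ _)).toAlgebra
  have hst : IsScalarTower k (MvPolynomial T k) L := IsScalarTower.of_algebraMap_eq fun x => by
    change _ = E (algebraMap _ _ _)
    rw [← IsScalarTower.algebraMap_apply, E.commutes]
  let E' : FractionRing (MvPolynomial T k) ≃ₐ[MvPolynomial T k] L :=
    AlgEquiv.ofRingEquiv (f := E.toRingEquiv) fun f => rfl
  have hE' (x) : E' x = E x := rfl
  have : IsFractionRing (MvPolynomial T k) L :=
    IsLocalization.isLocalization_of_algEquiv (nonZeroDivisors (MvPolynomial T k)) E'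
  have ha : a = fun i => algebraMap (MvPolynomial T k) L (f i) := funext fun i => (h i).symm
  rw [ha, separablyAlgebraicallyIndependent_algebraMap_iff]
  have := Fintype.ofFinite T
  have hD (w : T → FractionRing (MvPolynomial T k)) (g : MvPolynomial T k) :
      MvPolynomial.mkDerivation k (fun t => E' (w t)) g = E' (MvPolynomial.mkDerivation k w g) := by
    simp [mkDerivation_eq_sum_pderiv]
  constructor
  · intro H c hc
    have := H (fun i => E' (c i)) fun w => by
      obtain ⟨w, rfl⟩ : ∃ w', w = fun t => E' (w' t) := ⟨fun t => E'.symm (w t), by simp⟩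
      simp only [hD, ← map_mul, ← map_sum, hc, map_zero]
    ext1 i
    simpa using congrFun this i
  · intro H c hc
    obtain ⟨c, rfl⟩ : ∃ c', c = fun i => E' (c' i) := ⟨fun t => E'.symm (c t), by simp⟩
    have := H c fun w => by
      have := hc fun t => E' (w t)
      simpa only [hD, ← map_mul, ← map_sum, map_eq_zero_iff _ E'.injective] using this
    ext1 i
    simp [this]

end Differentials


/-! ### Function fields of rational varieties -/

theorem matrixIdeal_isPrime_of_eq_ker {k T : Type*} [Field k] {m n : ℕ}
    {Y : Set (Matrix (Fin m) (Fin n) (AlgebraicClosure k))}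
    {φ : Fin m × Fin n → MvPolynomial T k}
    (hI : matrixIdeal k Y = RingHom.ker (MvPolynomial.aeval φ).toRingHom) :
    (matrixIdeal k Y).IsPrime := by
  rw [hI]
  exact RingHom.ker_isPrime _

/-- If the polynomials `φ` parametrize `Y` birationally, then the function field of `Y` is the field
of rational functions in the parameters. -/
theorem exists_algEquiv_functionField {k T : Type*} [Field k] {m n : ℕ}
    {Y : Set (Matrix (Fin m) (Fin n) (AlgebraicClosure k))} [(matrixIdeal k Y).IsPrime]
    {φ : Fin m × Fin n → MvPolynomial T k}
    (hI : matrixIdeal k Y = RingHom.ker (MvPolynomial.aeval φ).toRingHom)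
    (hgen : IntermediateField.adjoin k (Set.range fun e =>
      algebraMap _ (FractionRing (MvPolynomial T k)) (φ e)) = ⊤) :
    ∃ E : FractionRing (MvPolynomial T k) ≃ₐ[k] FunctionField k Y,
      ∀ e, E (algebraMap _ _ (φ e)) = coordinateFunction k Y e := by
  let K := FractionRing (MvPolynomial T k)
  let ψ : CoordinateRing k Y →ₐ[k] K :=
    Ideal.Quotient.liftₐ (matrixIdeal k Y)
      ((IsScalarTower.toAlgHom k (MvPolynomial T k) K).comp (MvPolynomial.aeval φ)) (by
        intro a ha
        rw [hI] at ha
        have : MvPolynomial.aeval φ a = 0 := ha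
        rw [AlgHom.comp_apply, this, map_zero])
  have hψX (e) : ψ (Ideal.Quotient.mk _ (MvPolynomial.X e)) = algebraMap _ K (φ e) := by
    change algebraMap _ K (MvPolynomial.aeval φ (MvPolynomial.X e)) = _
    rw [MvPolynomial.aeval_X]
  have hψ : Function.Injective ψ := by
    rw [injective_iff_map_eq_zero]
    intro a ha
    obtain ⟨a, rfl⟩ := Ideal.Quotient.mk_surjective a
    rw [Ideal.Quotient.eq_zero_iff_mem, hI]
    have : algebraMap _ K (MvPolynomial.aeval φ a) = 0 := ha
    exact (map_eq_zero_iff _ (IsFractionRing.injective (MvPolynomial T k) K)).1 this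
  let Ψ : FunctionField k Y →ₐ[k] K := IsFractionRing.liftAlgHom (K := FunctionField k Y) hψ
  have hΨ (e) : Ψ (coordinateFunction k Y e) = algebraMap _ K (φ e) := by
    rw [← hψX]
    exact IsFractionRing.lift_algebraMap hψ _
  have hsurj : Function.Surjective Ψ := by
    rw [← AlgHom.fieldRange_eq_top, eq_top_iff, ← hgen, IntermediateField.adjoin_le_iff]
    rintro _ ⟨e, rfl⟩
    exact ⟨_, hΨ e⟩
  let E : FunctionField k Y ≃ₐ[k] K := AlgEquiv.ofBijective Ψ ⟨Ψ.toRingHom.injective, hsurj⟩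
  exact ⟨E.symm, fun e => by rw [← hΨ]; exact E.symm_apply_apply _⟩


/-! ### Charts of the varieties of matrices of bounded rank -/

section Chart

theorem eq_submatrix_fromRows {R ι δ ρ κ : Type*} (e : ι ≃ δ ⊕ ρ) (M : Matrix ι κ R) :
    M = (Matrix.fromRows (M.submatrix (e.symm ∘ Sum.inl) id)
      (M.submatrix (e.symm ∘ Sum.inr) id)).submatrix e id := by
  ext i j
  obtain ⟨x, rfl⟩ := e.symm.surjective i
  cases x <;> simp

variable {R S ι δ ρ κ : Type*} [CommRing R] [CommRing S] [DecidableEq δ] [DecidableEq ρ]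

/-- The matrix with an identity block on top of `P`. -/
def frame (e : ι ≃ δ ⊕ ρ) (P : Matrix ρ δ R) : Matrix ι δ R :=
  (Matrix.fromRows 1 P).submatrix e id

/-- The matrix with `-Pᵀ` on top of an identity block: its columns span the annihilator of the
columns of `frame e P`. -/
def coframe (e : ι ≃ δ ⊕ ρ) (P : Matrix ρ δ R) : Matrix ι ρ R :=
  (Matrix.fromRows (-P.transpose) 1).submatrix e id

theorem frame_map (e : ι ≃ δ ⊕ ρ) (P : Matrix ρ δ R) (f : R →+* S) :
    (frame e P).map f = frame e (P.map f) := by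
  ext i j
  rcases h : e i with a | a <;> simp [frame, h, Matrix.one_apply, apply_ite f]

theorem coframe_map (e : ι ≃ δ ⊕ ρ) (P : Matrix ρ δ R) (f : R →+* S) :
    (coframe e P).map f = coframe e (P.map f) := by
  ext i j
  rcases h : e i with a | a <;> simp [coframe, h, Matrix.one_apply, apply_ite f]

variable [Fintype ι] [Fintype δ] [Fintype ρ]

theorem frame_transpose_mul (e : ι ≃ δ ⊕ ρ) (P : Matrix ρ δ R) (M : Matrix ι κ R) :
    (frame e P).transpose * M = M.submatrix (e.symm ∘ Sum.inl) id +
      P.transpose * M.submatrix (e.symm ∘ Sum.inr) id := by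
  conv_lhs => rw [eq_submatrix_fromRows e M]
  rw [frame, Matrix.transpose_submatrix, Matrix.submatrix_mul_equiv, Matrix.transpose_fromRows,
    Matrix.fromCols_mul_fromRows]
  simp

theorem frame_transpose_mul_coframe (e : ι ≃ δ ⊕ ρ) (P : Matrix ρ δ R) :
    (frame e P).transpose * coframe e P = 0 := by
  rw [frame_transpose_mul]
  ext i j
  simp [coframe, Matrix.mul_apply, Matrix.one_apply]

/-- The hypothesis says that the upper block of `M` is `-Pᵀ` times its lower block, so the lower
block determines `M`. -/
theorem eq_coframe_mul_of_frame_transpose_mul_eq_zero (e : ι ≃ δ ⊕ ρ) (P : Matrix ρ δ R)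
    (M : Matrix ι κ R) (h : (frame e P).transpose * M = 0) :
    M = coframe e P * M.submatrix (e.symm ∘ Sum.inr) id := by
  rw [frame_transpose_mul] at h
  have h1 := eq_neg_of_add_eq_zero_left h
  conv_lhs => rw [eq_submatrix_fromRows e M, h1]
  rw [coframe, ← Matrix.submatrix_id_id (M.submatrix (e.symm ∘ Sum.inr) id),
    ← Matrix.submatrix_mul _ _ _ id _ Function.bijective_id, Matrix.fromRows_mul]
  simp

theorem eq_frame_mul (e : ι ≃ δ ⊕ ρ) (W : Matrix ι δ R)
    (h : IsUnit (W.submatrix (e.symm ∘ Sum.inl) id).det) :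
    W = frame e (W.submatrix (e.symm ∘ Sum.inr) id * (W.submatrix (e.symm ∘ Sum.inl) id)⁻¹) *
      W.submatrix (e.symm ∘ Sum.inl) id := by
  conv_lhs => rw [eq_submatrix_fromRows e W]
  rw [frame]
  conv_rhs => rw [← Matrix.submatrix_id_id (W.submatrix (e.symm ∘ Sum.inl) id)]
  rw [← Matrix.submatrix_mul _ _ _ id _ Function.bijective_id, Matrix.fromRows_mul,
    Matrix.mul_assoc, Matrix.submatrix_id_id, Matrix.nonsing_inv_mul _ h]
  simp

theorem eq_coframe_mul (e : ι ≃ δ ⊕ ρ) (V : Matrix ι ρ R)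
    (h : IsUnit (V.submatrix (e.symm ∘ Sum.inr) id).det) :
    V = coframe e (-(V.submatrix (e.symm ∘ Sum.inl) id *
      (V.submatrix (e.symm ∘ Sum.inr) id)⁻¹).transpose) * V.submatrix (e.symm ∘ Sum.inr) id := by
  conv_lhs => rw [eq_submatrix_fromRows e V]
  rw [coframe]
  conv_rhs => rw [← Matrix.submatrix_id_id (V.submatrix (e.symm ∘ Sum.inr) id)]
  rw [← Matrix.submatrix_mul _ _ _ id _ Function.bijective_id, Matrix.fromRows_mul,
    Matrix.submatrix_id_id, Matrix.transpose_neg, neg_neg, Matrix.transpose_transpose,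
    Matrix.mul_assoc, Matrix.nonsing_inv_mul _ h]
  simp

end Chart

/-! ### Rank factorizations and density of the charts -/

/-- The column space embeds in `K ^ d`; `L` extends this embedding and `X` inverts it, so `X * L` is
the identity on the column space. This form is chosen because for symmetric or alternating `A` it
can be applied on both sides, leaving a middle factor of the same type. -/
theorem exists_mul_mul_eq_of_rank_le {K ι κ : Type*} [Field K] [Fintype ι] [DecidableEq ι]
    [Fintype κ] (A : Matrix ι κ K) {d : ℕ} (h : A.rank ≤ d) :
    ∃ (X : Matrix ι (Fin d) K) (L : Matrix (Fin d) ι K), X * L * A = A := by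
  classical
  let W := LinearMap.range A.mulVecLin
  obtain ⟨q, hq⟩ := W.subtype.exists_leftInverse_of_injective W.ker_subtype
  obtain ⟨i, hi⟩ : ∃ i : W →ₗ[K] (Fin d → K), Function.Injective i := by
    have : Module.finrank K W ≤ Module.finrank K (Fin d → K) := by
      rw [Module.finrank_fin_fun]; exact h
    exact finrank_le_iff_exists_linearMap.1 this
  obtain ⟨j, hj⟩ := i.exists_leftInverse_of_injective (LinearMap.ker_eq_bot.2 hi)
  refine ⟨LinearMap.toMatrix' (W.subtype ∘ₗ j), LinearMap.toMatrix' (i ∘ₗ q), ?_⟩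
  rw [← LinearMap.toMatrix'_comp]
  conv_lhs => rw [← LinearMap.toMatrix'_toLin' A]
  conv_rhs => rw [← LinearMap.toMatrix'_toLin' A]
  rw [← LinearMap.toMatrix'_comp]
  congr 1
  have hA (w) : q (A.mulVec w) = ⟨A.mulVec w, w, rfl⟩ :=
    LinearMap.congr_fun hq ⟨A.mulVec w, w, rfl⟩
  have hji (w) : j (i w) = w := LinearMap.congr_fun hj w
  exact LinearMap.ext fun v => by simp [hA, hji]

/-- A polynomial that vanishes at the products `X * C * Yᵀ` for which the upper blocks of `X`
and `Y` are invertible vanishes at all such products. -/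
theorem aeval_eq_zero_of_forall_det_ne_zero {k K ι κ δ ρ ρ' : Type*} [Field k] [Field K]
    [Infinite K] [Algebra k K] [Fintype δ] [DecidableEq δ] [DecidableEq ρ] [DecidableEq ρ']
    (e : ι ≃ δ ⊕ ρ) (e' : κ ≃ δ ⊕ ρ') (f : MvPolynomial (ι × κ) k)
    (X₀ : Matrix ι δ K) (C₀ : Matrix δ δ K) (Y₀ : Matrix κ δ K)
    (h : ∀ s : K, ((X₀ + s • frame e 0).submatrix (e.symm ∘ Sum.inl) id).det ≠ 0 →
      ((Y₀ + s • frame e' 0).submatrix (e'.symm ∘ Sum.inl) id).det ≠ 0 →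
      MvPolynomial.aeval (fun x : ι × κ =>
        ((X₀ + s • frame e 0) * C₀ * (Y₀ + s • frame e' 0).transpose : Matrix ι κ K)
          x.1 x.2) f = 0) :
    MvPolynomial.aeval (fun x : ι × κ => (X₀ * C₀ * Y₀.transpose) x.1 x.2) f = 0 := by
  -- Both outer factors move along lines with parameter `s`. The value of `f` on the product is a
  -- polynomial `g` in `s`, and `p`, `q` are the determinants of the two upper blocks. Then `g * p *
  -- q` vanishes at every point of an infinite field while `p` and `q` are nonzero, so `g = 0`; the
  -- claim is its value at `s = 0`.
  open Polynomial in
  let XX : Matrix ι δ K[X] := X₀.map C + (X : K[X]) • frame e 0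
  let YY : Matrix κ δ K[X] := Y₀.map C + (X : K[X]) • frame e' 0
  let g : K[X] := MvPolynomial.aeval (fun x : ι × κ =>
    (XX * C₀.map C * YY.transpose) x.1 x.2) f
  let p : K[X] := (XX.submatrix (e.symm ∘ Sum.inl) id).det
  let q : K[X] := (YY.submatrix (e'.symm ∘ Sum.inl) id).det
  have hXX (s : K) : XX.map (evalRingHom s) = X₀ + s • frame e 0 := by
    have := frame_map e (0 : Matrix ρ δ K[X]) (evalRingHom s)
    ext i j
    have := congrFun (congrFun this i) j
    simp only [Matrix.map_apply, coe_evalRingHom] at this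
    simp [XX, this]
  have hYY (s : K) : YY.map (evalRingHom s) = Y₀ + s • frame e' 0 := by
    have := frame_map e' (0 : Matrix ρ' δ K[X]) (evalRingHom s)
    ext i j
    have := congrFun (congrFun this i) j
    simp only [Matrix.map_apply, coe_evalRingHom] at this
    simp [YY, this]
  have hC (s : K) : (C₀.map C).map (evalRingHom s) = C₀ := by
    ext i j; simp
  have hg (s : K) : eval s g = MvPolynomial.aeval (fun x : ι × κ =>
      ((X₀ + s • frame e 0) * C₀ * (Y₀ + s • frame e' 0).transpose : Matrix ι κ K) x.1 x.2) f := by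
    have hZ : (X₀ + s • frame e 0) * C₀ * (Y₀ + s • frame e' 0).transpose =
        (XX * C₀.map C * YY.transpose).map (evalRingHom s) := by
      rw [Matrix.map_mul, Matrix.map_mul, hC, hXX, Matrix.transpose_map, hYY]
    rw [hZ]
    exact MvPolynomial.comp_aeval_apply _ ((Polynomial.aeval s).restrictScalars k) f
  have hp (s : K) : eval s p = ((X₀ + s • frame e 0).submatrix (e.symm ∘ Sum.inl) id).det := by
    rw [← hXX, Matrix.submatrix_map, ← RingHom.mapMatrix_apply, ← RingHom.map_det]; rfl
  have hq (s : K) : eval s q = ((Y₀ + s • frame e' 0).submatrix (e'.symm ∘ Sum.inl) id).det := by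
    rw [← hYY, Matrix.submatrix_map, ← RingHom.mapMatrix_apply, ← RingHom.map_det]; rfl
  -- The determinant of `X • 1 + M` is monic in `X`, hence nonzero.
  have hdet (M : Matrix δ δ K) : (M.map C + (X : K[X]) • (1 : Matrix δ δ K[X])).det ≠ 0 := by
    rw [add_comm]
    intro h0
    have := leadingCoeff_det_X_one_add_C M
    rw [h0] at this
    simp at this
  have hp0 : p ≠ 0 := by
    convert hdet (X₀.submatrix (e.symm ∘ Sum.inl) id)
    ext i j
    simp [XX, frame]
  have hq0 : q ≠ 0 := by
    convert hdet (Y₀.submatrix (e'.symm ∘ Sum.inl) id)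
    ext i j
    simp [YY, frame]
  have hgpq : g * p * q = 0 := by
    refine Polynomial.funext fun s => ?_
    rw [eval_mul, eval_mul, eval_zero]
    by_cases h1 : eval s p = 0
    · simp [h1]
    by_cases h2 : eval s q = 0
    · simp [h2]
    rw [hg, h s (hp s ▸ h1) (hq s ▸ h2)]
    simp
  have hg0 : g = 0 := by
    simpa [hp0, hq0] using hgpq
  have := hg 0
  rw [hg0] at this
  simpa using this.symm


/-! ### Symmetric and alternating matrices -/

section SymOrAlt

/-- The sign of the transposition: `-1` for alternating and `1` for symmetric matrices. -/
def transposeSign (R : Type*) [CommRing R] : Bool → R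
  | true => -1
  | false => 1

theorem transposeSign_mul_self (R : Type*) [CommRing R] (b : Bool) :
    transposeSign R b * transposeSign R b = 1 := by
  cases b <;> simp [transposeSign]

theorem map_transposeSign {R S : Type*} [CommRing R] [CommRing S] (f : R →+* S) (b : Bool) :
    f (transposeSign R b) = transposeSign S b := by
  cases b <;> simp [transposeSign]

/-- Alternating matrices for `b = true`, symmetric matrices for `b = false`. -/
structure IsSymOrAlt {R ι : Type*} [CommRing R] (b : Bool) (M : Matrix ι ι R) : Prop where
  transpose_eq : M.transpose = transposeSign R b • M
  diag_eq_zero : b = true → ∀ i, M i i = 0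

variable {R S ι κ : Type*} [CommRing R] [CommRing S] {b : Bool}

theorem IsSymOrAlt.apply_swap {M : Matrix ι ι R} (h : IsSymOrAlt b M) (i j : ι) :
    M j i = transposeSign R b * M i j :=
  congrFun (congrFun h.transpose_eq i) j

theorem IsSymOrAlt.submatrix {M : Matrix ι ι R} (h : IsSymOrAlt b M) (f : κ → ι) :
    IsSymOrAlt b (M.submatrix f f) :=
  ⟨by ext i j; exact h.apply_swap _ _, fun hb i => h.diag_eq_zero hb _⟩

theorem IsSymOrAlt.mul_mul_transpose [Fintype ι] {M : Matrix ι ι R} (h : IsSymOrAlt b M)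
    (U : Matrix κ ι R) : IsSymOrAlt b (U * M * U.transpose) := by
  refine ⟨?_, ?_⟩
  · rw [Matrix.transpose_mul, Matrix.transpose_mul, Matrix.transpose_transpose, h.transpose_eq,
      Matrix.smul_mul, Matrix.mul_smul, Matrix.mul_assoc]
  · rintro rfl i
    simp only [Matrix.mul_apply, Finset.sum_mul, Matrix.transpose_apply]
    rw [← Finset.sum_product' Finset.univ Finset.univ fun y x => U i x * M x y * U i y]
    -- The terms at `(x, y)` and `(y, x)` cancel, and those with `x = y` are zero. No division by
    -- two is involved, so characteristic two is covered.
    refine Finset.sum_involution (fun x _ => x.swap) ?_ ?_ ?_ ?_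
    · rintro ⟨x, y⟩ -
      simp only [Prod.fst_swap, Prod.snd_swap, h.apply_swap x y, transposeSign]
      ring
    · rintro ⟨x, y⟩ - hne heq
      obtain rfl : y = x := congrArg Prod.fst heq
      exact hne (by simp [h.diag_eq_zero rfl])
    · simp
    · simp

theorem isSymOrAlt_add_transpose (W : Matrix ι ι R) :
    IsSymOrAlt b (W + transposeSign R b • W.transpose) := by
  refine ⟨?_, ?_⟩
  · rw [smul_add, smul_smul, transposeSign_mul_self, one_smul, Matrix.transpose_add,
      Matrix.transpose_smul, Matrix.transpose_transpose, add_comm]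
  · rintro rfl i
    simp [transposeSign]

/-- A symmetric matrix is halved. An alternating matrix is the antisymmetrization of its strict
upper triangle, in every characteristic. -/
theorem IsSymOrAlt.exists_eq_add_transpose {K : Type*} [Field K] [LinearOrder ι]
    (hb : b = false → (2 : K) ≠ 0) {M : Matrix ι ι K} (h : IsSymOrAlt b M) :
    ∃ W : Matrix ι ι K, M = W + transposeSign K b • W.transpose := by
  cases b with
  | false =>
    have h2 := hb rfl
    refine ⟨(2 : K)⁻¹ • M, ?_⟩
    have := h.transpose_eq
    simp only [transposeSign, one_smul] at this ⊢
    rw [Matrix.transpose_smul, this, ← add_smul]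
    have : (2 : K)⁻¹ + 2⁻¹ = 1 := by field_simp; norm_num
    rw [this, one_smul]
  | true =>
    refine ⟨Matrix.of fun i j => if i < j then M i j else 0, ?_⟩
    ext i j
    rcases lt_trichotomy i j with hij | rfl | hij
    · simp [transposeSign, hij, hij.not_gt]
    · simp [h.diag_eq_zero rfl]
    · simp [transposeSign, hij, hij.not_gt, h.apply_swap j i]

/-- The index sets of the entries of alternating and of symmetric matrices. -/
def EntryRel {n : ℕ} : Bool → Fin n → Fin n → Prop
  | true, i, j => i < j
  | false, i, j => i ≤ j

instance {n : ℕ} (b : Bool) (i j : Fin n) : Decidable (EntryRel b i j) := by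
  cases b <;> unfold EntryRel <;> infer_instance

/-- The pairs of indices that are the free entries of an alternating or symmetric matrix. -/
abbrev EntryIndex (b : Bool) (n : ℕ) : Type := {e : Fin n × Fin n // EntryRel b e.1 e.2}

theorem EntryRel.le {n : ℕ} {i j : Fin n} (h : EntryRel b i j) : i ≤ j := by
  cases b
  · exact h
  · exact le_of_lt h

theorem EntryRel.of_lt {n : ℕ} {i j : Fin n} (h : i < j) : EntryRel b i j := by
  cases b
  · exact le_of_lt h
  · exact h

theorem EntryRel.eq_false {n : ℕ} {i : Fin n} (h : EntryRel b i i) : b = false := by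
  cases b
  · rfl
  · exact absurd h (lt_irrefl i)

/-- The alternating or symmetric matrix with given free entries. -/
def ofEntries {n : ℕ} (b : Bool) (c : EntryIndex b n → R) : Matrix (Fin n) (Fin n) R := fun i j =>
  if h : EntryRel b i j then c ⟨(i, j), h⟩
  else if h : EntryRel b j i then transposeSign R b * c ⟨(j, i), h⟩ else 0

theorem ofEntries_apply {n : ℕ} (c : EntryIndex b n → R) (e : EntryIndex b n) :
    ofEntries b c e.1.1 e.1.2 = c e := by
  rw [ofEntries, dif_pos e.2]

theorem isSymOrAlt_ofEntries {n : ℕ} (c : EntryIndex b n → R) : IsSymOrAlt b (ofEntries b c) := by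
  refine ⟨?_, ?_⟩
  · ext i j
    rw [Matrix.transpose_apply, Matrix.smul_apply, smul_eq_mul, ofEntries, ofEntries]
    by_cases h1 : EntryRel b i j <;> by_cases h2 : EntryRel b j i
    · obtain rfl := le_antisymm h1.le h2.le
      obtain rfl := h1.eq_false
      simp [transposeSign]
    · simp [h1, h2]
    · simp [h1, h2, ← mul_assoc, transposeSign_mul_self]
    · simp [h1, h2]
  · rintro rfl i
    have : ¬ EntryRel true i i := lt_irrefl i
    simp [ofEntries, this]

theorem IsSymOrAlt.eq_of_forall_entries {n : ℕ} {M N : Matrix (Fin n) (Fin n) R}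
    (hM : IsSymOrAlt b M) (hN : IsSymOrAlt b N)
    (h : ∀ e : EntryIndex b n, M e.1.1 e.1.2 = N e.1.1 e.1.2) : M = N := by
  ext i j
  rcases lt_trichotomy i j with hij | rfl | hij
  · exact h ⟨(i, j), .of_lt hij⟩
  · cases b
    · exact h ⟨(i, i), le_refl i⟩
    · rw [hM.diag_eq_zero rfl, hN.diag_eq_zero rfl]
  · rw [hM.apply_swap j i, hN.apply_swap j i, h ⟨(j, i), .of_lt hij⟩]

theorem IsSymOrAlt.ofEntries_eq {n : ℕ} {M : Matrix (Fin n) (Fin n) R} (hM : IsSymOrAlt b M) :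
    ofEntries b (fun e => M e.1.1 e.1.2) = M :=
  (isSymOrAlt_ofEntries _).eq_of_forall_entries hM fun _ => ofEntries_apply _ _

theorem ofEntries_map {n : ℕ} (c : EntryIndex b n → R) (f : R →+* S) :
    (ofEntries b c).map f = ofEntries b (fun e => f (c e)) := by
  ext i j
  simp only [Matrix.map_apply, ofEntries]
  split_ifs <;> simp [map_transposeSign]

theorem ofEntries_add {n : ℕ} (c c' : EntryIndex b n → R) :
    ofEntries b (c + c') = ofEntries b c + ofEntries b c' := by
  ext i j
  simp only [Matrix.add_apply, ofEntries]
  split_ifs <;> simp [mul_add]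

theorem ofEntries_smul {n : ℕ} (r : R) (c : EntryIndex b n → R) :
    ofEntries b (r • c) = r • ofEntries b c := by
  ext i j
  simp only [Matrix.smul_apply, ofEntries]
  split_ifs <;> simp [mul_left_comm]

end SymOrAlt

/-! ### Independence in the dual of a represented matroid -/

/-- `S` is coindependent when its complement contains a base, that is, when the vectors outside `S`
span all the others; spanning is tested by linear functionals. -/
theorem representedMatroid_dual_indep_iff {F V α : Type*} [Field F] [AddCommGroup V] [Module F V]
    [Finite α] (v : α → V) (S : Set α) :
    (representedMatroid F v).dual.Indep S ↔
      ∀ f : V →ₗ[F] F, (∀ e, e ∉ S → f (v e) = 0) → ∀ e, f (v e) = 0 := by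
  have hE : (representedMatroid F v).E = Set.univ := rfl
  have hspan {B X : Set α} (hB : (representedMatroid F v).IsBasis B X) {e : α} (he : e ∈ X) :
      v e ∈ Submodule.span F (v '' B) := by
    by_cases heB : e ∈ B
    · exact Submodule.subset_span ⟨e, heB, rfl⟩
    · by_contra hne
      exact heB (hB.mem_of_insert_indep he ((linearIndepOn_insert heB).2 ⟨hB.indep, hne⟩))
  change (representedMatroid F v).Coindep S ↔ _
  rw [Matroid.coindep_iff_exists (hX := hE ▸ Set.subset_univ _)]
  constructor
  · rintro ⟨B, hB, hBS⟩ f hf e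
    have he := hspan hB.isBasis_ground (hE ▸ Set.mem_univ e)
    suffices Submodule.span F (v '' B) ≤ LinearMap.ker f from this he
    rw [Submodule.span_le]
    rintro _ ⟨x, hx, rfl⟩
    exact hf x (hBS hx).2
  · intro h
    obtain ⟨B, hB⟩ := (representedMatroid F v).exists_isBasis ((representedMatroid F v).E \ S)
    -- If `B` could be enlarged by `e`, a functional would vanish on the span of `B`, hence on all
    -- vectors outside `S`, but not at `v e`.
    refine ⟨B, hB.indep.isBase_of_forall_insert fun e he hi => ?_, hB.subset⟩
    have hne := ((linearIndepOn_insert he.2).1 hi).2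
    obtain ⟨f, hf, hfB⟩ := Submodule.exists_le_ker_of_notMem hne
    refine hf (h f (fun x hx => hfB (hspan hB ⟨hE ▸ Set.mem_univ x, hx⟩)) e)

theorem mul_mul_transpose_apply {F ι κ σ τ : Type*} [CommRing F] [Fintype σ] [Fintype τ]
    (U : Matrix ι σ F) (B : Matrix σ τ F) (V : Matrix κ τ F) (i : ι) (j : κ) :
    (U * B * V.transpose) i j = U i ⬝ᵥ (B.mulVec (V j)) := by
  rw [Matrix.mul_assoc, Matrix.mul_apply']
  rfl

/-- Functionals on the tensor product are bilinear forms, hence matrices `B`, and the value at `uᵢ ⊗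
vⱼ` is an entry of `U * B * Vᵀ`. -/
theorem tensorMatroid_dual_indep_iff {F : Type*} [Field F] {m n s r : ℕ}
    (u : Fin m → Fin s → F) (v : Fin n → Fin r → F) (S : Set (Fin m × Fin n)) :
    (tensorMatroid u v).dual.Indep S ↔
      ∀ B : Matrix (Fin s) (Fin r) F,
        (∀ e, e ∉ S → (Matrix.of u * B * (Matrix.of v).transpose) e.1 e.2 = 0) →
          Matrix.of u * B * (Matrix.of v).transpose = 0 := by
  rw [tensorMatroid, representedMatroid_dual_indep_iff]
  constructor
  · intro h B hB
    have key (i j) : TensorProduct.lift (Matrix.toLinearMap₂' F B) (u i ⊗ₜ v j) =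
        (Matrix.of u * B * (Matrix.of v).transpose) i j := by
      rw [mul_mul_transpose_apply, TensorProduct.lift.tmul, Matrix.toLinearMap₂'_apply']
      rfl
    ext i j
    rw [← key]
    exact h _ (fun e he => by rw [key]; exact hB e he) (i, j)
  · intro h f
    have key (i j) : (Matrix.of u * LinearMap.toMatrix₂' F (TensorProduct.curry f) *
        (Matrix.of v).transpose) i j = f (u i ⊗ₜ v j) := by
      rw [mul_mul_transpose_apply, ← Matrix.toLinearMap₂'_apply', Matrix.toLinearMap₂'_toMatrix']
      rfl
    intro hf e
    have := h (LinearMap.toMatrix₂' F (TensorProduct.curry f)) fun e he => by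
      rw [key]; exact hf e he
    rw [← key, this]
    rfl


/-! ### Functionals on symmetric and exterior squares -/

/-- In the polynomial ring the functional is half of `∑ B a b ∂ₐ ∂_b`, evaluated at the origin. On a
product of two linear forms `∂ₐ ∂_b` gives `x a * y b + x b * y a`, so a symmetric `B` is counted
twice. -/
theorem exists_functional_symmetricAlgebra {F : Type*} [Field F] (h2 : (2 : F) ≠ 0) {r : ℕ}
    {B : Matrix (Fin r) (Fin r) F} (hB : IsSymOrAlt false B) :
    ∃ f : SymmetricAlgebra F (Fin r → F) →ₗ[F] F, ∀ x y : Fin r → F,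
      f (SymmetricAlgebra.ι F _ x * SymmetricAlgebra.ι F _ y) = x ⬝ᵥ B.mulVec y := by
  let Φ := SymmetricAlgebra.equivMvPolynomial (Pi.basisFun F (Fin r))
  have hΦ (x : Fin r → F) : Φ (SymmetricAlgebra.ι F _ x) =
      ∑ a, MvPolynomial.C (x a) * MvPolynomial.X a := by
    conv_lhs => rw [← (Pi.basisFun F (Fin r)).sum_repr x]
    simp only [map_sum, map_smul, Φ, SymmetricAlgebra.equivMvPolynomial_ι_apply,
      MvPolynomial.smul_eq_C_mul, Pi.basisFun_repr]
  have hd (x : Fin r → F) (a : Fin r) :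
      MvPolynomial.pderiv a (Φ (SymmetricAlgebra.ι F _ x)) = MvPolynomial.C (x a) := by
    simp [hΦ, Pi.single_apply]
  have hc (x : Fin r → F) : MvPolynomial.constantCoeff (Φ (SymmetricAlgebra.ι F _ x)) = 0 := by
    simp [hΦ]
  let q (a b : Fin r) : SymmetricAlgebra F (Fin r → F) →ₗ[F] F :=
    (MvPolynomial.aeval (0 : Fin r → F)).toLinearMap ∘ₗ
      ((MvPolynomial.pderiv a).toLinearMap ∘ₗ (MvPolynomial.pderiv b).toLinearMap) ∘ₗ
        Φ.toLinearMap
  have hq (a b x y) : q a b (SymmetricAlgebra.ι F _ x * SymmetricAlgebra.ι F _ y) =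
      x a * y b + x b * y a := by
    have : q a b (SymmetricAlgebra.ι F _ x * SymmetricAlgebra.ι F _ y) =
      MvPolynomial.aeval (0 : Fin r → F) (MvPolynomial.pderiv a (MvPolynomial.pderiv b
        (Φ (SymmetricAlgebra.ι F _ x * SymmetricAlgebra.ι F _ y)))) := rfl
    rw [this, map_mul, Derivation.leibniz, hd, hd, map_add, smul_eq_mul, smul_eq_mul,
      Derivation.leibniz, Derivation.leibniz, hd, hd, MvPolynomial.pderiv_C, MvPolynomial.pderiv_C]
    simp
    ring
  refine ⟨(2 : F)⁻¹ • ∑ a, ∑ b, B a b • q a b, fun x y => ?_⟩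
  have hBs (a b) : B b a = B a b := by simpa [transposeSign] using hB.apply_swap a b
  simp only [LinearMap.smul_apply, LinearMap.sum_apply, hq, smul_eq_mul, mul_add,
    Finset.sum_add_distrib]
  have h1 : ∑ a, ∑ b, B a b * (x a * y b) = x ⬝ᵥ B.mulVec y := by
    simp only [dotProduct, Matrix.mulVec, Finset.mul_sum]
    exact Finset.sum_congr rfl fun a _ => Finset.sum_congr rfl fun b _ => by ring
  have h3 : ∑ a, ∑ b, B a b * (x b * y a) = x ⬝ᵥ B.mulVec y := by
    rw [Finset.sum_comm, ← h1]
    exact Finset.sum_congr rfl fun a _ => Finset.sum_congr rfl fun b _ => by rw [hBs]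
  rw [h1, h3]
  field_simp
  ring

theorem exists_matrix_of_functional_symmetricAlgebra {F : Type*} [Field F] {r : ℕ}
    (f : SymmetricAlgebra F (Fin r → F) →ₗ[F] F) :
    ∃ B : Matrix (Fin r) (Fin r) F, IsSymOrAlt false B ∧ ∀ x y : Fin r → F,
      f (SymmetricAlgebra.ι F _ x * SymmetricAlgebra.ι F _ y) = x ⬝ᵥ B.mulVec y := by
  let g : (Fin r → F) →ₗ[F] (Fin r → F) →ₗ[F] F :=
    ((LinearMap.mul F (SymmetricAlgebra F (Fin r → F))).compr₂ f).compl₁₂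
      (SymmetricAlgebra.ι F _) (SymmetricAlgebra.ι F _)
  have hg (x y) : g x y = f (SymmetricAlgebra.ι F _ x * SymmetricAlgebra.ι F _ y) := rfl
  refine ⟨LinearMap.toMatrix₂' F g, ⟨?_, by simp⟩, fun x y => ?_⟩
  · ext a b
    simp only [transposeSign, one_smul, Matrix.transpose_apply, LinearMap.toMatrix₂'_apply, hg]
    rw [mul_comm]
  · rw [← hg, ← Matrix.toLinearMap₂'_apply', Matrix.toLinearMap₂'_toMatrix']

theorem symmetricPowerMatroid_dual_indep_iff {F : Type*} [Field F] (h2 : (2 : F) ≠ 0) {n r : ℕ}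
    (v : Fin n → Fin r → F) (S : Set (SymIndex n)) :
    (symmetricPowerMatroid v).dual.Indep S ↔
      ∀ B : Matrix (Fin r) (Fin r) F, IsSymOrAlt false B →
        (∀ e : SymIndex n, e ∉ S →
          (Matrix.of v * B * (Matrix.of v).transpose) e.1.1 e.1.2 = 0) →
        Matrix.of v * B * (Matrix.of v).transpose = 0 := by
  rw [symmetricPowerMatroid, representedMatroid_dual_indep_iff]
  constructor
  · intro h B hB hS
    obtain ⟨f, hf⟩ := exists_functional_symmetricAlgebra h2 hB
    refine (hB.mul_mul_transpose _).eq_of_forall_entries (b := false) ⟨by simp, by simp⟩ fun e => ?_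
    have := h f (fun e he => by
      rw [hf]
      exact (mul_mul_transpose_apply _ _ _ _ _).symm.trans (hS e he)) e
    rw [hf] at this
    exact (mul_mul_transpose_apply _ _ _ _ _).trans this
  · intro h f hS e
    obtain ⟨B, hB, hf⟩ := exists_matrix_of_functional_symmetricAlgebra f
    have := h B hB fun e he => by
      rw [mul_mul_transpose_apply]
      exact (hf _ _).symm.trans (hS e he)
    rw [hf]
    refine (mul_mul_transpose_apply (Matrix.of v) B (Matrix.of v) _ _).symm.trans ?_
    rw [this]; rfl

theorem dotProduct_mulVec_self_of_isSymOrAlt {F : Type*} [Field F] {r : ℕ}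
    {B : Matrix (Fin r) (Fin r) F} (hB : IsSymOrAlt true B) (x : Fin r → F) :
    x ⬝ᵥ B.mulVec x = 0 := by
  have := (hB.mul_mul_transpose (Matrix.of fun _ : Unit => x)).diag_eq_zero rfl ()
  rwa [mul_mul_transpose_apply] at this

/-- The alternating form of an alternating matrix. -/
def alternatingMapOfMatrix {F : Type*} [Field F] {r : ℕ}
    (B : Matrix (Fin r) (Fin r) F) (hB : IsSymOrAlt true B) : (Fin r → F) [⋀^Fin 2]→ₗ[F] F where
  toFun v := v 0 ⬝ᵥ B.mulVec (v 1)
  map_update_add' v i x y := by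
    fin_cases i <;> simp [Matrix.mulVec_add, add_dotProduct, dotProduct_add]
  map_update_smul' v i c x := by
    fin_cases i <;> simp [Matrix.mulVec_smul]
  map_eq_zero_of_eq' v i j h hij := by
    have h01 : v 0 = v 1 := by
      fin_cases i <;> fin_cases j <;> simp_all
    rw [h01]
    exact dotProduct_mulVec_self_of_isSymOrAlt hB _

theorem exists_matrix_of_functional_exteriorPower {F : Type*} [Field F] {r : ℕ}
    (f : ⋀[F]^2 (Fin r → F) →ₗ[F] F) :
    ∃ B : Matrix (Fin r) (Fin r) F, IsSymOrAlt true B ∧ ∀ x y : Fin r → F,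
      f (exteriorPower.ιMulti F 2 ![x, y]) = x ⬝ᵥ B.mulVec y := by
  let a : (Fin r → F) [⋀^Fin 2]→ₗ[F] F := f.compAlternatingMap (exteriorPower.ιMulti F 2)
  have ha (x y) : a ![x, y] = f (exteriorPower.ιMulti F 2 ![x, y]) := rfl
  have hswap (x y) : a ![y, x] = - a ![x, y] := by
    rw [← a.map_swap _ (show (0 : Fin 2) ≠ 1 by decide)]
    congr 1
    ext i : 1
    fin_cases i <;> rfl
  have hadd (x x' y) : a ![x + x', y] = a ![x, y] + a ![x', y] :=
    a.map_vecCons_add ![y] x x'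
  have hsmul (c : F) (x y) : a ![c • x, y] = c • a ![x, y] := a.map_vecCons_smul ![y] c x
  let g : (Fin r → F) →ₗ[F] (Fin r → F) →ₗ[F] F :=
    LinearMap.mk₂ F (fun x y => a ![x, y]) hadd hsmul
      -- Linearity in the second argument follows from linearity in the first by swapping twice.
      (fun x y y' => by rw [hswap, hadd, hswap y, hswap y']; ring)
      (fun c x y => by rw [hswap, hsmul, hswap y]; simp)
  have hg (x y) : g x y = a ![x, y] := rfl
  refine ⟨LinearMap.toMatrix₂' F g, ⟨?_, fun _ i => ?_⟩, fun x y => ?_⟩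
  · ext i j
    simp only [transposeSign, neg_smul, one_smul, Matrix.transpose_apply, Matrix.neg_apply,
      LinearMap.toMatrix₂'_apply, hg]
    rw [hswap]
  · rw [LinearMap.toMatrix₂'_apply, hg]
    exact a.map_eq_zero_of_eq _ (i := 0) (j := 1) rfl (by decide)
  · rw [← ha, ← hg, ← Matrix.toLinearMap₂'_apply', Matrix.toLinearMap₂'_toMatrix']

theorem wedgePowerMatroid_dual_indep_iff {F : Type*} [Field F] {n r : ℕ}
    (v : Fin n → Fin r → F) (S : Set (SkewIndex n)) :
    (wedgePowerMatroid v).dual.Indep S ↔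
      ∀ B : Matrix (Fin r) (Fin r) F, IsSymOrAlt true B →
        (∀ e : SkewIndex n, e ∉ S →
          (Matrix.of v * B * (Matrix.of v).transpose) e.1.1 e.1.2 = 0) →
        Matrix.of v * B * (Matrix.of v).transpose = 0 := by
  rw [wedgePowerMatroid, representedMatroid_dual_indep_iff]
  constructor
  · intro h B hB hS
    have hf (x y) : exteriorPower.alternatingMapLinearEquiv (alternatingMapOfMatrix B hB)
        (exteriorPower.ιMulti F 2 ![x, y]) = x ⬝ᵥ B.mulVec y := by
      rw [exteriorPower.alternatingMapLinearEquiv_apply_ιMulti]; rfl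
    refine (hB.mul_mul_transpose _).eq_of_forall_entries (b := true) ⟨by simp, by simp⟩ fun e => ?_
    have := h _ (fun e he => by
      rw [hf]
      exact (mul_mul_transpose_apply _ _ _ _ _).symm.trans (hS e he)) e
    rw [hf] at this
    exact (mul_mul_transpose_apply _ _ _ _ _).trans this
  · intro h f hS e
    obtain ⟨B, hB, hf⟩ := exists_matrix_of_functional_exteriorPower f
    have := h B hB fun e he => by
      rw [mul_mul_transpose_apply]
      exact (hf _ _).symm.trans (hS e he)
    rw [hf]
    refine (mul_mul_transpose_apply (Matrix.of v) B (Matrix.of v) _ _).symm.trans ?_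
    rw [this]; rfl


/-! ### Specialization of generic matrices -/

/-- An integer polynomial vanishing at algebraically independent elements in characteristic `p` has
all coefficients divisible by `p`, so it vanishes identically in every ring of characteristic `p`.
Working over the integers lets a generic point over one field specialize to a point over an
unrelated one. -/
theorem aeval_int_eq_zero_of_algebraicIndependent {K₀ F R T : Type*} [Field K₀] [CommRing F]
    [CommRing R] [Algebra K₀ F] (p : ℕ) [CharP K₀ p] [CharP R p] {x : T → F}
    (hx : AlgebraicIndependent K₀ x) (y : T → R) {q : MvPolynomial T ℤ}
    (hq : MvPolynomial.aeval x q = 0) : MvPolynomial.aeval y q = 0 := by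
  have hmap : MvPolynomial.map (Int.castRingHom K₀) q = 0 := by
    refine hx (?_ : MvPolynomial.aeval x _ = MvPolynomial.aeval x 0)
    rw [map_zero, ← hq, ← algebraMap_int_eq, MvPolynomial.aeval_map_algebraMap]
  have hdvd (m) : (p : ℤ) ∣ q.coeff m := by
    have := congrArg (MvPolynomial.coeff m) hmap
    rw [MvPolynomial.coeff_map, MvPolynomial.coeff_zero] at this
    exact (CharP.intCast_eq_zero_iff K₀ p _).1 this
  have hmap' : MvPolynomial.map (Int.castRingHom R) q = 0 := by
    ext m
    rw [MvPolynomial.coeff_map, MvPolynomial.coeff_zero]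
    exact (CharP.intCast_eq_zero_iff R p _).2 (hdvd m)
  have : MvPolynomial.aeval y q = MvPolynomial.eval y (MvPolynomial.map (Int.castRingHom R) q) := by
    rw [MvPolynomial.eval_map]; rfl
  rw [this, hmap', map_zero]

/-- An injective matrix has full column rank, so some of its rows form a basis of the row space; `g`
selects them. -/
theorem exists_submatrix_det_ne_zero {K ι τ : Type*} [Field K] [Finite ι] [Fintype τ]
    [DecidableEq τ]
    (Z : Matrix ι τ K) (h : ∀ v, Z.mulVec v = 0 → v = 0) :
    ∃ g : τ → ι, (Z.submatrix g id).det ≠ 0 := by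
  have hrank : Module.finrank K (Submodule.span K (Set.range Z.row)) = Fintype.card τ := by
    rw [← Matrix.rank_eq_finrank_span_row, Matrix.rank, LinearMap.finrank_range_of_inj,
      Module.finrank_fintype_fun_eq_card]
    exact (injective_iff_map_eq_zero _).2 h
  obtain ⟨f, hf, -, hli⟩ := Submodule.exists_fun_fin_finrank_span_eq K (Set.range Z.row)
  choose g hg using hf
  let E : τ ≃ Fin (Module.finrank K (Submodule.span K (Set.range Z.row))) :=
    (Fintype.equivFin τ).trans (finCongr hrank.symm)
  refine ⟨g ∘ E, ?_⟩
  have hrow : (Z.submatrix (g ∘ E) id).row = f ∘ E := by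
    ext1 i
    exact hg (E i)
  have := Matrix.linearIndependent_rows_iff_isUnit.1 (hrow ▸ hli.comp E E.injective)
  exact ((Matrix.isUnit_iff_isUnit_det _).1 this).ne_zero

/-- Injectivity of a matrix is preserved by generization. -/
theorem mulVec_eq_zero_of_ker_le {R F K ι τ : Type*} [CommRing R] [Field F] [Field K]
    [Finite ι] [Fintype τ] (f : R →+* F) (g : R →+* K) (hfg : RingHom.ker f ≤ RingHom.ker g)
    (Z : Matrix ι τ R) (h : ∀ v, (Z.map g).mulVec v = 0 → v = 0) (v : τ → F)
    (hv : (Z.map f).mulVec v = 0) : v = 0 := by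
  classical
  -- A maximal minor that survives `g` also survives `f`, because the kernel of `f` is the smaller
  -- one.
  obtain ⟨s, hs⟩ := exists_submatrix_det_ne_zero _ h
  have hf : ((Z.map f).submatrix s id).det ≠ 0 := by
    rw [Matrix.submatrix_map, ← RingHom.mapMatrix_apply, ← RingHom.map_det] at hs ⊢
    exact fun h0 => hs (hfg h0)
  refine Matrix.eq_zero_of_mulVec_eq_zero hf ?_
  ext i
  exact congrFun hv (s i)

/-- No nonzero matrix `B` makes `U * B * Vᵀ` vanish outside `S`. -/
def SupportInjective {F σ τ : Type*} [CommRing F] [Fintype σ] [Fintype τ] {m n : ℕ}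
    (S : Set (Fin m × Fin n)) (U : Matrix (Fin m) σ F) (V : Matrix (Fin n) τ F) : Prop :=
  ∀ B : Matrix σ τ F, (∀ e, e ∉ S → (U * B * V.transpose) e.1 e.2 = 0) → B = 0

/-- No nonzero symmetric or alternating matrix `B` makes `U * B * Uᵀ` vanish outside `S`. -/
def SymOrAltSupportInjective {F : Type*} [CommRing F] {n r : ℕ} (b : Bool)
    (S : Set (EntryIndex b n)) (U : Matrix (Fin n) (Fin r) F) : Prop :=
  ∀ B : Matrix (Fin r) (Fin r) F, IsSymOrAlt b B →
    (∀ e : EntryIndex b n, e ∉ S → (U * B * U.transpose) e.1.1 e.1.2 = 0) → B = 0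

/-- The matrix of the linear system expressing that `U * B * Vᵀ` vanishes outside `S`. -/
def supportMatrix {R σ τ : Type*} [CommRing R] {m n : ℕ} (S : Set (Fin m × Fin n))
    (U : Matrix (Fin m) σ R) (V : Matrix (Fin n) τ R) : Matrix {e // e ∉ S} (σ × τ) R :=
  Matrix.of fun e t => U e.1.1 t.1 * V e.1.2 t.2

theorem supportMatrix_map_mulVec {R L σ τ : Type*} [CommRing R] [CommRing L] [Fintype σ]
    [Fintype τ] {m n : ℕ} (S : Set (Fin m × Fin n)) (U : Matrix (Fin m) σ R)
    (V : Matrix (Fin n) τ R) (φ : R →+* L) (B : Matrix σ τ L) (e : {e // e ∉ S}) :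
    ((supportMatrix S U V).map φ).mulVec (fun t => B t.1 t.2) e =
      (U.map φ * B * (V.map φ).transpose) e.1.1 e.1.2 := by
  rw [mul_mul_transpose_apply]
  simp only [Matrix.mulVec, dotProduct, Fintype.sum_prod_type, Matrix.map_apply, supportMatrix,
    Matrix.of_apply, map_mul, Finset.mul_sum]
  exact Finset.sum_congr rfl fun a _ => Finset.sum_congr rfl fun b _ => by ring

theorem SupportInjective.of_ker_le {R F K σ τ : Type*} [CommRing R] [Field F] [Field K]
    [Fintype σ] [Fintype τ] {m n : ℕ} {S : Set (Fin m × Fin n)} {f : R →+* F} {g : R →+* K}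
    (hfg : RingHom.ker f ≤ RingHom.ker g) {U : Matrix (Fin m) σ R} {V : Matrix (Fin n) τ R}
    (h : SupportInjective S (U.map g) (V.map g)) : SupportInjective S (U.map f) (V.map f) := by
  intro B hB
  have := mulVec_eq_zero_of_ker_le f g hfg (supportMatrix S U V) (fun v hv => ?_)
    (fun t => B t.1 t.2) ?_
  · ext a b
    exact congrFun this (a, b)
  · have := h (Matrix.of fun a b => v (a, b)) fun e he => by
      rw [← supportMatrix_map_mulVec S U V g _ ⟨e, he⟩]
      exact congrFun hv ⟨e, he⟩
    ext t
    exact congrFun (congrFun this t.1) t.2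
  · ext e
    exact (supportMatrix_map_mulVec S U V f B e).trans (hB e.1 e.2)

/-- The matrix of the linear system expressing that `U * B * Uᵀ` vanishes outside `S`, in terms of
the free entries of the symmetric or alternating matrix `B`. -/
def symOrAltSupportMatrix {R : Type*} [CommRing R] {n r : ℕ} (b : Bool) (S : Set (EntryIndex b n))
    (U : Matrix (Fin n) (Fin r) R) : Matrix {e // e ∉ S} (EntryIndex b r) R :=
  Matrix.of fun e t =>
    (U * ofEntries b (fun j => if t = j then (1 : R) else 0) * U.transpose) e.1.1.1 e.1.1.2

theorem symOrAltSupportMatrix_map_mulVec {R L : Type*} [CommRing R] [CommRing L] {n r : ℕ}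
    (b : Bool) (S : Set (EntryIndex b n)) (U : Matrix (Fin n) (Fin r) R) (φ : R →+* L)
    (c : EntryIndex b r → L) (e : {e // e ∉ S}) :
    ((symOrAltSupportMatrix b S U).map φ).mulVec c e =
      (U.map φ * ofEntries b c * (U.map φ).transpose) e.1.1.1 e.1.1.2 := by
  -- The right side is linear in `c`, so it suffices to compare both sides on indicator vectors,
  -- which give the columns of the support matrix.
  let ℓ : (EntryIndex b r → L) →ₗ[L] L :=
    { toFun := fun c => (U.map φ * ofEntries b c * (U.map φ).transpose) e.1.1.1 e.1.1.2
      map_add' := fun c c' => by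
        rw [ofEntries_add, Matrix.mul_add, Matrix.add_mul, Matrix.add_apply]
      map_smul' := fun a c => by
        rw [ofEntries_smul, Matrix.mul_smul, Matrix.smul_mul, Matrix.smul_apply]; rfl }
  change _ = ℓ c
  rw [LinearMap.pi_apply_eq_sum_univ]
  refine Finset.sum_congr rfl fun t _ => ?_
  rw [smul_eq_mul, mul_comm]
  congr 1
  have hmap : (U * ofEntries b (fun j => if t = j then (1 : R) else 0) * U.transpose).map φ =
      U.map φ * ofEntries b (fun j => if t = j then (1 : L) else 0) * (U.map φ).transpose := by
    rw [Matrix.map_mul, Matrix.map_mul, ofEntries_map, Matrix.transpose_map]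
    simp only [apply_ite φ, map_one, map_zero]
  exact congrFun (congrFun hmap _) _

theorem SymOrAltSupportInjective.of_ker_le {R F K : Type*} [CommRing R] [Field F] [Field K]
    {n r : ℕ} {b : Bool} {S : Set (EntryIndex b n)} {f : R →+* F} {g : R →+* K}
    (hfg : RingHom.ker f ≤ RingHom.ker g) {U : Matrix (Fin n) (Fin r) R}
    (h : SymOrAltSupportInjective b S (U.map g)) : SymOrAltSupportInjective b S (U.map f) := by
  intro B hBs hB
  have := mulVec_eq_zero_of_ker_le f g hfg (symOrAltSupportMatrix b S U) (fun v hv => ?_)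
    (fun t => B t.1.1 t.1.2) ?_
  · rw [← hBs.ofEntries_eq, this]
    refine (isSymOrAlt_ofEntries _).eq_of_forall_entries (b := b) ⟨by simp, by simp⟩ fun e => ?_
    rw [ofEntries_apply]; rfl
  · have := h _ (isSymOrAlt_ofEntries v) fun e he => by
      rw [← symOrAltSupportMatrix_map_mulVec b S U g v ⟨e, he⟩]
      exact congrFun hv ⟨e, he⟩
    ext t
    rw [← ofEntries_apply v t, this]; rfl
  · ext e
    rw [symOrAltSupportMatrix_map_mulVec, hBs.ofEntries_eq]
    exact hB e.1 e.2


/-! ### Comparison of generic vectors with generic charts -/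

/-- The lower block of a coframe is the identity, so `B` can be read off the product. In particular
the product vanishes only for `B = 0`. -/
theorem coframe_mul_mul_submatrix {R ι ι' δ δ' ρ ρ' : Type*} [CommRing R] [DecidableEq ρ]
    [DecidableEq ρ'] [Fintype ρ] [Fintype ρ'] (e : ι ≃ δ ⊕ ρ) (e' : ι' ≃ δ' ⊕ ρ')
    (P : Matrix ρ δ R) (Q : Matrix ρ' δ' R) (B : Matrix ρ ρ' R) :
    (coframe e P * B * (coframe e' Q).transpose).submatrix (e.symm ∘ Sum.inr)
      (e'.symm ∘ Sum.inr) = B := by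
  have h1 : (coframe e P).submatrix (e.symm ∘ Sum.inr) id = 1 := by
    ext i j; simp [coframe]
  have h2 : (coframe e' Q).transpose.submatrix id (e'.symm ∘ Sum.inr) = 1 := by
    ext i j; simp [coframe, Matrix.one_apply, eq_comm]
  rw [Matrix.submatrix_mul _ _ _ id _ Function.bijective_id,
    Matrix.submatrix_mul _ _ _ id _ Function.bijective_id, h1, h2]
  simp

theorem ker_aeval_le_of_algebraicIndependent {K₀ F R T : Type*} [Field K₀] [CommRing F]
    [CommRing R] [Algebra K₀ F] (p : ℕ) [CharP K₀ p] [CharP R p] {x : T → F}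
    (hx : AlgebraicIndependent K₀ x) (y : T → R) :
    RingHom.ker (MvPolynomial.aeval (R := ℤ) x).toRingHom ≤
      RingHom.ker (MvPolynomial.aeval (R := ℤ) y).toRingHom :=
  fun _ hq => aeval_int_eq_zero_of_algebraicIndependent p hx y hq

instance charP_bot_subfield (F : Type*) [Field F] (p : ℕ) [CharP F p] :
    CharP (⊥ : Subfield F) p :=
  (⊥ : Subfield F).subtype.charP (⊥ : Subfield F).subtype.injective p

/-- The determinant is an integer polynomial in the coordinates. Vanishing at a generic point would
force vanishing at the coframe of the zero matrix, whose lower block is the identity. -/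
theorem det_submatrix_ne_zero_of_totallyGeneric {F δ : Type*} [Field F] {n r : ℕ}
    (e : Fin n ≃ δ ⊕ Fin r) {v : Fin n → Fin r → F} (hv : TotallyGeneric v) :
    ((Matrix.of v).submatrix (e.symm ∘ Sum.inr) id).det ≠ 0 := by
  obtain ⟨p, hp⟩ := CharP.exists F
  let G : Matrix (Fin n) (Fin r) (MvPolynomial (Fin n × Fin r) ℤ) :=
    Matrix.of fun i a => MvPolynomial.X (i, a)
  have hG (y : Fin n × Fin r → F) : (MvPolynomial.aeval (R := ℤ) y).toRingHom
      (G.submatrix (e.symm ∘ Sum.inr) id).det =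
        ((Matrix.of fun i a => y (i, a)).submatrix (e.symm ∘ Sum.inr) id).det := by
    rw [RingHom.map_det, RingHom.mapMatrix_apply]
    congr 1
    ext i a
    simp [G]
  intro h0
  have := ker_aeval_le_of_algebraicIndependent p hv (fun t => coframe e (0 : Matrix _ δ F) t.1 t.2)
    ((hG _).trans h0)
  rw [RingHom.mem_ker, hG] at this
  refine one_ne_zero (α := F) (Eq.trans ?_ this)
  rw [← Matrix.det_one (n := Fin r)]
  congr 1
  ext i a
  simp [coframe]

/-- The invertible column changes `G` and `H` are absorbed by replacing `B` with `G⁻¹ * B * (H⁻¹)ᵀ`.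
-/
theorem coframe_supportInjective {F δ δ' : Type*} [Field F] {m n s r : ℕ}
    (e : Fin m ≃ δ ⊕ Fin s) (e' : Fin n ≃ δ' ⊕ Fin r) {S : Set (Fin m × Fin n)}
    {U : Matrix (Fin m) (Fin s) F} {V : Matrix (Fin n) (Fin r) F}
    {P : Matrix (Fin s) δ F} {Q : Matrix (Fin r) δ' F}
    {G : Matrix (Fin s) (Fin s) F} {H : Matrix (Fin r) (Fin r) F}
    (hG : G.det ≠ 0) (hH : H.det ≠ 0) (hU : U = coframe e P * G) (hV : V = coframe e' Q * H)
    (h : ∀ B : Matrix (Fin s) (Fin r) F, (∀ e, e ∉ S → (U * B * V.transpose) e.1 e.2 = 0) →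
      U * B * V.transpose = 0) :
    SupportInjective S (coframe e P) (coframe e' Q) := by
  intro B hB
  have key : U * (G⁻¹ * B * (H⁻¹).transpose) * V.transpose =
      coframe e P * B * (coframe e' Q).transpose := by
    have h1 : G * G⁻¹ = 1 := Matrix.mul_nonsing_inv _ hG.isUnit
    have h2 : (H⁻¹).transpose * H.transpose = 1 := by
      rw [← Matrix.transpose_mul, Matrix.mul_nonsing_inv _ hH.isUnit, Matrix.transpose_one]
    rw [hU, hV, Matrix.transpose_mul]
    calc coframe e P * G * (G⁻¹ * B * (H⁻¹).transpose) * (H.transpose * (coframe e' Q).transpose)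
        = coframe e P * (G * G⁻¹) * B * ((H⁻¹).transpose * H.transpose) *
          (coframe e' Q).transpose := by simp only [Matrix.mul_assoc]
      _ = _ := by rw [h1, h2, Matrix.mul_one, Matrix.mul_one]
  have := h (G⁻¹ * B * (H⁻¹).transpose) (by rwa [key])
  rw [key] at this
  rw [← coframe_mul_mul_submatrix e e' P Q B, this]
  rfl

theorem coframe_symOrAltSupportInjective {F δ : Type*} [Field F] {n r : ℕ} {b : Bool}
    (e : Fin n ≃ δ ⊕ Fin r) {S : Set (EntryIndex b n)}
    {V : Matrix (Fin n) (Fin r) F} {P : Matrix (Fin r) δ F}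
    {G : Matrix (Fin r) (Fin r) F} (hG : G.det ≠ 0) (hV : V = coframe e P * G)
    (h : ∀ B : Matrix (Fin r) (Fin r) F, IsSymOrAlt b B →
      (∀ e : EntryIndex b n, e ∉ S → (V * B * V.transpose) e.1.1 e.1.2 = 0) →
        V * B * V.transpose = 0) :
    SymOrAltSupportInjective b S (coframe e P) := by
  intro B hBs hB
  have key : V * (G⁻¹ * B * (G⁻¹).transpose) * V.transpose =
      coframe e P * B * (coframe e P).transpose := by
    have h1 : G * G⁻¹ = 1 := Matrix.mul_nonsing_inv _ hG.isUnit
    have h2 : (G⁻¹).transpose * G.transpose = 1 := by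
      rw [← Matrix.transpose_mul, h1, Matrix.transpose_one]
    rw [hV, Matrix.transpose_mul]
    calc coframe e P * G * (G⁻¹ * B * (G⁻¹).transpose) * (G.transpose * (coframe e P).transpose)
        = coframe e P * (G * G⁻¹) * B * ((G⁻¹).transpose * G.transpose) *
          (coframe e P).transpose := by simp only [Matrix.mul_assoc]
      _ = _ := by rw [h1, h2, Matrix.mul_one, Matrix.mul_one]
  have := h (G⁻¹ * B * (G⁻¹).transpose) (hBs.mul_mul_transpose _) (by rwa [key])
  rw [key] at this
  rw [← coframe_mul_mul_submatrix e e P P B, this]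
  rfl

/-- Each side is generic enough to specialize to the other. Column operations turn `u` and `v` into
coframes of some `P₁` and `Q₁` over `F`, to which the generic `P` and `Q` specialize; conversely,
`u` and `v` specialize to the two coframes. Injectivity passes from the special point to the generic
one. -/
theorem supportInjective_coframe_iff {F K K₀ δ : Type*} [Field F] [Field K] [Field K₀]
    [Algebra K₀ K] [DecidableEq δ] [Fintype δ] (p : ℕ) [CharP F p] [CharP K p] [CharP K₀ p]
    {m n s r : ℕ} (e : Fin m ≃ δ ⊕ Fin s) (e' : Fin n ≃ δ ⊕ Fin r) (S : Set (Fin m × Fin n))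
    {u : Fin m → Fin s → F} {v : Fin n → Fin r → F} (huv : JointlyTotallyGeneric u v)
    {P : Matrix (Fin s) δ K} {Q : Matrix (Fin r) δ K}
    (hPQ : AlgebraicIndependent K₀ (Sum.elim (fun t : Fin s × δ => P t.1 t.2)
      (fun t : Fin r × δ => Q t.1 t.2))) :
    (∀ B : Matrix (Fin s) (Fin r) F,
      (∀ e, e ∉ S → (Matrix.of u * B * (Matrix.of v).transpose) e.1 e.2 = 0) →
      Matrix.of u * B * (Matrix.of v).transpose = 0) ↔
        SupportInjective S (coframe e P) (coframe e' Q) := by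
  constructor
  · intro h
    have hu : TotallyGeneric u := huv.comp Sum.inl Sum.inl_injective
    have hv : TotallyGeneric v := huv.comp Sum.inr Sum.inr_injective
    have hud := det_submatrix_ne_zero_of_totallyGeneric e hu
    have hvd := det_submatrix_ne_zero_of_totallyGeneric e' hv
    have h1 := coframe_supportInjective e e' hud hvd (eq_coframe_mul e _ hud.isUnit)
      (eq_coframe_mul e' _ hvd.isUnit) h
    set P₁ := -((Matrix.of u).submatrix (e.symm ∘ Sum.inl) id *
      ((Matrix.of u).submatrix (e.symm ∘ Sum.inr) id)⁻¹).transpose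
    set Q₁ := -((Matrix.of v).submatrix (e'.symm ∘ Sum.inl) id *
      ((Matrix.of v).submatrix (e'.symm ∘ Sum.inr) id)⁻¹).transpose
    let P₀ : Matrix (Fin s) δ (MvPolynomial ((Fin s × δ) ⊕ (Fin r × δ)) ℤ) :=
      Matrix.of fun i j => MvPolynomial.X (Sum.inl (i, j))
    let Q₀ : Matrix (Fin r) δ (MvPolynomial ((Fin s × δ) ⊕ (Fin r × δ)) ℤ) :=
      Matrix.of fun i j => MvPolynomial.X (Sum.inr (i, j))
    have hker := ker_aeval_le_of_algebraicIndependent p hPQ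
      (Sum.elim (fun t : Fin s × δ => P₁ t.1 t.2) (fun t : Fin r × δ => Q₁ t.1 t.2))
    have := SupportInjective.of_ker_le (S := S) hker (U := coframe e P₀) (V := coframe e' Q₀)
    rw [coframe_map, coframe_map, coframe_map, coframe_map] at this
    convert this ?_
    · ext i j; simp [P₀]
    · ext i j; simp [Q₀]
    convert h1
    · ext i j; simp [P₀]
    · ext i j; simp [Q₀]
  · intro h B hB
    let U₀ : Matrix (Fin m) (Fin s) (MvPolynomial ((Fin m × Fin s) ⊕ (Fin n × Fin r)) ℤ) :=
      Matrix.of fun i j => MvPolynomial.X (Sum.inl (i, j))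
    let V₀ : Matrix (Fin n) (Fin r) (MvPolynomial ((Fin m × Fin s) ⊕ (Fin n × Fin r)) ℤ) :=
      Matrix.of fun i j => MvPolynomial.X (Sum.inr (i, j))
    have hker := ker_aeval_le_of_algebraicIndependent p huv
      (Sum.elim (fun t : Fin m × Fin s => coframe e P t.1 t.2)
        (fun t : Fin n × Fin r => coframe e' Q t.1 t.2))
    have := SupportInjective.of_ker_le (S := S) hker (U := U₀) (V := V₀) (by
      convert h
      · ext i j; simp [U₀]
      · ext i j; simp [V₀])
    rw [this B, Matrix.mul_zero, Matrix.zero_mul]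
    convert hB
    · ext i j; simp [U₀]
    · ext i j; simp [V₀]

/-- The same two specializations apply with one family of vectors; the column change acts on `B` by
congruence, which preserves symmetric and alternating matrices. -/
theorem symOrAltSupportInjective_coframe_iff {F K K₀ δ : Type*} [Field F] [Field K] [Field K₀]
    [Algebra K₀ K] [DecidableEq δ] [Fintype δ] (p : ℕ) [CharP F p] [CharP K p] [CharP K₀ p]
    {n r : ℕ} {b : Bool} (e : Fin n ≃ δ ⊕ Fin r) (S : Set (EntryIndex b n))
    {v : Fin n → Fin r → F} (hv : TotallyGeneric v) {P : Matrix (Fin r) δ K}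
    (hP : AlgebraicIndependent K₀ (fun t : Fin r × δ => P t.1 t.2)) :
    (∀ B : Matrix (Fin r) (Fin r) F, IsSymOrAlt b B → (∀ e : EntryIndex b n, e ∉ S →
      (Matrix.of v * B * (Matrix.of v).transpose) e.1.1 e.1.2 = 0) →
        Matrix.of v * B * (Matrix.of v).transpose = 0) ↔
      SymOrAltSupportInjective b S (coframe e P) := by
  constructor
  · intro h
    have hvd := det_submatrix_ne_zero_of_totallyGeneric e hv
    have h1 := coframe_symOrAltSupportInjective e hvd (eq_coframe_mul e _ hvd.isUnit) h
    set P₁ := -((Matrix.of v).submatrix (e.symm ∘ Sum.inl) id *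
      ((Matrix.of v).submatrix (e.symm ∘ Sum.inr) id)⁻¹).transpose
    let P₀ : Matrix (Fin r) δ (MvPolynomial (Fin r × δ) ℤ) :=
      Matrix.of fun i j => MvPolynomial.X (i, j)
    have hker := ker_aeval_le_of_algebraicIndependent p hP (fun t : Fin r × δ => P₁ t.1 t.2)
    have := SymOrAltSupportInjective.of_ker_le (S := S) hker (U := coframe e P₀)
    rw [coframe_map, coframe_map] at this
    convert this ?_
    · ext i j; simp [P₀]
    convert h1
    ext i j; simp [P₀]
  · intro h B hBs hB
    let V₀ : Matrix (Fin n) (Fin r) (MvPolynomial (Fin n × Fin r) ℤ) :=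
      Matrix.of fun i j => MvPolynomial.X (i, j)
    have hker := ker_aeval_le_of_algebraicIndependent p hv
      (fun t : Fin n × Fin r => coframe e P t.1 t.2)
    have := SymOrAltSupportInjective.of_ker_le (S := S) hker (U := V₀) (by
      convert h
      ext i j; simp [V₀])
    rw [this B hBs, Matrix.mul_zero, Matrix.zero_mul]
    convert hB
    · ext i j; simp [V₀]
    · ext i j; simp [V₀]


/-! ### Tangent spaces of the charts -/

section Tangent

variable {L ι κ δ ρ ρ' : Type*} [Field L] [Fintype ι] [Fintype κ] [Fintype δ] [Fintype ρ]
  [Fintype ρ'] [DecidableEq ρ'] [DecidableEq δ] [DecidableEq ρ]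

/-- The matrix with a zero block on top of `P`. -/
def tailBlock {R ι δ ρ : Type*} [Zero R] (e : ι ≃ δ ⊕ ρ) (P : Matrix ρ δ R) : Matrix ι δ R :=
  (Matrix.fromRows 0 P).submatrix e id

theorem tailBlock_zero (e : ι ≃ δ ⊕ ρ) : tailBlock e (0 : Matrix ρ δ L) = 0 := by
  simp [tailBlock]

theorem mul_tailBlock (e : ι ≃ δ ⊕ ρ) (H : Matrix κ ι L) (P : Matrix ρ δ L) :
    H * tailBlock e P = H.submatrix id (e.symm ∘ Sum.inr) * P := by
  ext i j
  simp only [Matrix.mul_apply, tailBlock, Matrix.submatrix_apply]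
  rw [← e.symm.sum_comp]
  simp

theorem trace_transpose_mul_eq_sum (M N : Matrix ι κ L) :
    (M.transpose * N).trace = ∑ i, ∑ j, M i j * N i j := by
  rw [Finset.sum_comm]
  rfl

/-- Nondegeneracy of the trace form turns the directions `C'` into `(frame e P)ᵀ * (M * Y) = 0`, and
the directions `P'`, as `C` is invertible, into vanishing of the lower block of `M * Y`. A matrix
killed by the transposed frame is determined by its lower block. -/
theorem forall_trace_tangent_eq_zero_iff (e : ι ≃ δ ⊕ ρ) (P : Matrix ρ δ L) (Y : Matrix κ δ L)
    {C : Matrix δ δ L} (hC : C.det ≠ 0) (M : Matrix ι κ L) :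
    (∀ (C' : Matrix δ δ L) (P' : Matrix ρ δ L), (M.transpose *
      (tailBlock e P' * C * Y.transpose + frame e P * C' * Y.transpose)).trace = 0) ↔
      M * Y = 0 := by
  have hcomm (A : Matrix ι δ L) (B : Matrix δ δ L) : (M.transpose * (A * B * Y.transpose)).trace =
      (B * (M * Y).transpose * A).trace := by
    rw [Matrix.trace_mul_comm, Matrix.mul_assoc, Matrix.mul_assoc, Matrix.trace_mul_comm,
      Matrix.transpose_mul, Matrix.mul_assoc, Matrix.mul_assoc]
  constructor
  · intro h
    have h1 : (frame e P).transpose * (M * Y) = 0 := by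
      rw [← Matrix.transpose_inj, Matrix.transpose_mul, Matrix.transpose_transpose,
        Matrix.transpose_zero, Matrix.ext_iff_trace_mul_left]
      intro W
      have := h W 0
      rw [tailBlock_zero, Matrix.zero_mul, Matrix.zero_mul, zero_add, hcomm] at this
      rw [← Matrix.mul_assoc, this, Matrix.mul_zero, Matrix.trace_zero]
    have h2 : C * ((M * Y).submatrix (e.symm ∘ Sum.inr) id).transpose = 0 := by
      rw [Matrix.ext_iff_trace_mul_right]
      intro W
      have := h 0 W
      rw [Matrix.mul_zero, Matrix.zero_mul, add_zero, hcomm, mul_tailBlock] at this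
      rw [Matrix.zero_mul, Matrix.trace_zero, ← this]
      congr 2
    have h3 : (M * Y).submatrix (e.symm ∘ Sum.inr) id = 0 := by
      rw [← Matrix.transpose_inj, ← Matrix.one_mul (Matrix.transpose _),
        ← Matrix.nonsing_inv_mul C hC.isUnit, Matrix.mul_assoc, h2, Matrix.mul_zero,
        Matrix.transpose_zero]
    rw [eq_coframe_mul_of_frame_transpose_mul_eq_zero e P _ h1, h3, Matrix.mul_zero]
  · intro h C' P'
    rw [Matrix.mul_add, Matrix.trace_add, hcomm, hcomm, h]
    simp

/-- The derivative of `frame e P * C * (frame e' Q)ᵀ` in the direction `(C', P', Q')`. -/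
def chartTangent (e : ι ≃ δ ⊕ ρ) (e' : κ ≃ δ ⊕ ρ') (C : Matrix δ δ L) (P : Matrix ρ δ L)
    (Q : Matrix ρ' δ L) (C' : Matrix δ δ L) (P' : Matrix ρ δ L) (Q' : Matrix ρ' δ L) :
    Matrix ι κ L :=
  tailBlock e P' * C * (frame e' Q).transpose + frame e P * C' * (frame e' Q).transpose +
    frame e P * C * (tailBlock e' Q').transpose

/-- The directions `(C', P')` give the condition on the right of `M`. The directions `(C', Q')` are
the same situation transposed and give the condition on the left. -/
theorem forall_trace_tangent_eq_zero_iff_and (e : ι ≃ δ ⊕ ρ) (e' : κ ≃ δ ⊕ ρ') (P : Matrix ρ δ L)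
    (Q : Matrix ρ' δ L) {C : Matrix δ δ L} (hC : C.det ≠ 0) (M : Matrix ι κ L) :
    (∀ (C' : Matrix δ δ L) (P' : Matrix ρ δ L) (Q' : Matrix ρ' δ L),
      (M.transpose * chartTangent e e' C P Q C' P' Q').trace = 0) ↔
      (frame e P).transpose * M = 0 ∧ M * frame e' Q = 0 := by
  have h3 : (frame e P).transpose * M = 0 ↔ M.transpose * frame e P = 0 := by
    rw [← Matrix.transpose_inj, Matrix.transpose_mul, Matrix.transpose_transpose,
      Matrix.transpose_zero]
  rw [h3, and_comm, ← forall_trace_tangent_eq_zero_iff e P (frame e' Q) hC M]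
  constructor
  · intro h
    refine ⟨fun C' P' => ?_, ?_⟩
    · have := h C' P' 0
      rwa [chartTangent, tailBlock_zero, Matrix.transpose_zero, Matrix.mul_zero, add_zero] at this
    · rw [← forall_trace_tangent_eq_zero_iff e' Q (frame e P) (C := C.transpose)
        (by rwa [Matrix.det_transpose])]
      intro C' Q'
      rw [← h C'.transpose 0 Q', ← Matrix.trace_transpose, Matrix.transpose_mul,
        Matrix.transpose_transpose, Matrix.trace_mul_comm, chartTangent, tailBlock_zero,
        Matrix.zero_mul, Matrix.zero_mul, zero_add, Matrix.transpose_add, add_comm]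
      simp only [Matrix.transpose_mul, Matrix.transpose_transpose, Matrix.mul_assoc]
  · rintro ⟨h1, h2⟩ C' P' Q'
    rw [chartTangent, Matrix.mul_add, Matrix.trace_add, h1, zero_add, ← Matrix.mul_assoc,
      ← Matrix.mul_assoc, h2, Matrix.zero_mul, Matrix.zero_mul, Matrix.trace_zero]

theorem eq_coframe_mul_mul_coframe (e : ι ≃ δ ⊕ ρ) (e' : κ ≃ δ ⊕ ρ') (P : Matrix ρ δ L)
    (Q : Matrix ρ' δ L) (M : Matrix ι κ L) (h : (frame e P).transpose * M = 0)
    (h' : M * frame e' Q = 0) :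
    M = coframe e P * M.submatrix (e.symm ∘ Sum.inr) (e'.symm ∘ Sum.inr) *
      (coframe e' Q).transpose := by
  have h1 := eq_coframe_mul_of_frame_transpose_mul_eq_zero e P M h
  have h2 := eq_coframe_mul_of_frame_transpose_mul_eq_zero e' Q M.transpose (by
    rw [← Matrix.transpose_mul, h', Matrix.transpose_zero])
  rw [← Matrix.transpose_inj, Matrix.transpose_transpose, Matrix.transpose_mul] at h2
  conv_lhs => rw [h1, h2]
  rw [Matrix.mul_assoc]
  congr 1

theorem coframe_mul_mul_coframe_mul_frame (e : ι ≃ δ ⊕ ρ) (e' : κ ≃ δ ⊕ ρ') (P : Matrix ρ δ L)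
    (Q : Matrix ρ' δ L) (B : Matrix ρ ρ' L) :
    coframe e P * B * (coframe e' Q).transpose * frame e' Q = 0 := by
  have : (coframe e' Q).transpose * frame e' Q = 0 := by
    rw [← Matrix.transpose_inj, Matrix.transpose_mul, Matrix.transpose_transpose,
      frame_transpose_mul_coframe, Matrix.transpose_zero]
  rw [Matrix.mul_assoc, this, Matrix.mul_zero]

/-- Coefficients indexed by a subset are the same as coefficients that vanish outside of it. -/
theorem forall_coefficients_subset_iff {E : Type*} [Fintype E] (S : Set E) [Fintype S]
    (H : Set (E → L)) :
    (∀ c : S → L, (∀ N ∈ H, ∑ i, c i * N i = 0) → c = 0) ↔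
      ∀ c : E → L, (∀ i, i ∉ S → c i = 0) → (∀ N ∈ H, ∑ i, c i * N i = 0) → c = 0 := by
  classical
  have hsum (c : E → L) (hc : ∀ i, i ∉ S → c i = 0) (N : E → L) :
      ∑ i : S, c i * N i = ∑ i, c i * N i := by
    rw [← Finset.sum_subset (Finset.subset_univ S.toFinset)]
    · exact (Finset.sum_subtype S.toFinset (p := (· ∈ S)) (by simp) fun i => c i * N i).symm
    · intro i _ hi
      rw [hc i (by simpa using hi), zero_mul]
  constructor
  · intro h c hc hN
    have := h (fun i => c i) fun N hN' => (hsum c hc N).trans (hN N hN')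
    ext i
    by_cases hi : i ∈ S
    · exact congrFun this ⟨i, hi⟩
    · exact hc i hi
  · intro h c hN
    let c' : E → L := fun i => if hi : i ∈ S then c ⟨i, hi⟩ else 0
    have hcc (i : S) : c' i = c i := dif_pos i.2
    have hc' (i) (hi : i ∉ S) : c' i = 0 := dif_neg hi
    have := h c' hc' fun N hN' => by
      rw [← hsum c' hc']
      simp only [hcc]
      exact hN N hN'
    ext i
    rw [← hcc, this]; rfl

end Tangent

/-- The differentials of the entries in `S` of a chart of the matrices of bounded rank are
independent exactly when no nonzero conormal vector is supported on `S`. -/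
theorem tangent_independent_iff {L : Type*} [Field L] {m n d s r : ℕ}
    (e : Fin m ≃ Fin d ⊕ Fin s) (e' : Fin n ≃ Fin d ⊕ Fin r) (S : Set (Fin m × Fin n)) [Fintype S]
    {C : Matrix (Fin d) (Fin d) L} (hC : C.det ≠ 0) (P : Matrix (Fin s) (Fin d) L)
    (Q : Matrix (Fin r) (Fin d) L) :
    (∀ c : S → L, (∀ (C' : Matrix (Fin d) (Fin d) L) (P' : Matrix (Fin s) (Fin d) L)
      (Q' : Matrix (Fin r) (Fin d) L),
        ∑ i : S, c i * chartTangent e e' C P Q C' P' Q' i.1.1 i.1.2 = 0) → c = 0) ↔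
      SupportInjective S (coframe e P) (coframe e' Q) := by
  have hH := forall_coefficients_subset_iff S
    {N : Fin m × Fin n → L | ∃ C' P' Q', N = fun i => chartTangent e e' C P Q C' P' Q' i.1 i.2}
  have hcond₁ (c : S → L) :
      (∀ N ∈ {N : Fin m × Fin n → L | ∃ C' P' Q', N = fun i =>
        chartTangent e e' C P Q C' P' Q' i.1 i.2}, ∑ i : S, c i * N i = 0) ↔
      ∀ C' P' Q', ∑ i : S, c i * chartTangent e e' C P Q C' P' Q' i.1.1 i.1.2 = 0 :=
    ⟨fun h C' P' Q' => h _ ⟨C', P', Q', rfl⟩, by rintro h _ ⟨C', P', Q', rfl⟩; exact h C' P' Q'⟩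
  have hcond₂ (c : Fin m × Fin n → L) :
      (∀ N ∈ {N : Fin m × Fin n → L | ∃ C' P' Q', N = fun i =>
        chartTangent e e' C P Q C' P' Q' i.1 i.2}, ∑ i, c i * N i = 0) ↔
      ∀ C' P' Q', ∑ i, c i * chartTangent e e' C P Q C' P' Q' i.1 i.2 = 0 :=
    ⟨fun h C' P' Q' => h _ ⟨C', P', Q', rfl⟩, by rintro h _ ⟨C', P', Q', rfl⟩; exact h C' P' Q'⟩
  simp only [hcond₁, hcond₂] at hH
  rw [hH]
  -- A coefficient vector extended by zero is a matrix `M`, its pairing with a tangent vector is the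
  -- trace form, and annihilating all tangent vectors means being conormal.
  have hM (M : Matrix (Fin m) (Fin n) L) :
      (∀ C' P' Q', ∑ i : Fin m × Fin n, M i.1 i.2 * chartTangent e e' C P Q C' P' Q' i.1 i.2 = 0) ↔
        (frame e P).transpose * M = 0 ∧ M * frame e' Q = 0 := by
    rw [← forall_trace_tangent_eq_zero_iff_and e e' P Q hC]
    simp only [trace_transpose_mul_eq_sum, Fintype.sum_prod_type]
  constructor
  · intro h B hB
    have := h (fun i => (coframe e P * B * (coframe e' Q).transpose) i.1 i.2) hB
      ((hM _).2 ⟨?_, coframe_mul_mul_coframe_mul_frame e e' P Q B⟩)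
    · rw [← coframe_mul_mul_submatrix e e' P Q B]
      ext i j
      exact congrFun this (_, _)
    · rw [← Matrix.mul_assoc, ← Matrix.mul_assoc, frame_transpose_mul_coframe, Matrix.zero_mul,
        Matrix.zero_mul]
  · intro h c hc hN
    obtain ⟨h1, h2⟩ := (hM (Matrix.of fun i j => c (i, j))).1 hN
    have h3 := eq_coframe_mul_mul_coframe e e' P Q _ h1 h2
    have h4 := h _ fun i hi => by
      rw [← h3]
      exact hc i hi
    rw [h4, Matrix.mul_zero, Matrix.zero_mul] at h3
    ext i
    exact congrFun (congrFun h3 i.1) i.2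

/-! ### Tangent spaces of the symmetric and alternating charts -/

/-- The upper triangular matrix with given entries. -/
def upperOfEntries {R : Type*} [Zero R] {n : ℕ} (b : Bool) (c : EntryIndex b n → R) :
    Matrix (Fin n) (Fin n) R :=
  fun i j => if h : EntryRel b i j then c ⟨(i, j), h⟩ else 0

theorem upperOfEntries_add_transpose_apply {R : Type*} [CommRing R] {n : ℕ} {b : Bool}
    (c : EntryIndex b n → R) (e : EntryIndex b n) :
    (upperOfEntries b c + transposeSign R b • (upperOfEntries b c).transpose) e.1.1 e.1.2 =
      if e.1.1 = e.1.2 then 2 * c e else c e := by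
  obtain ⟨⟨i, j⟩, h⟩ := e
  change EntryRel b i j at h
  simp only [Matrix.add_apply, Matrix.smul_apply, Matrix.transpose_apply, upperOfEntries,
    dif_pos h]
  split_ifs with h1 h2 h2
  · subst h2
    obtain rfl := h.eq_false
    simp [transposeSign, two_mul]
  · exact absurd (le_antisymm h.le h1.le) h2
  · exact absurd (h2 ▸ h : EntryRel b j j) (h2 ▸ h1)
  · simp

theorem sum_entries_eq_trace {L : Type*} [Field L] {n : ℕ} {b : Bool} (c : EntryIndex b n → L)
    (N : Matrix (Fin n) (Fin n) L) :
    ∑ i, c i * N i.1.1 i.1.2 = ((upperOfEntries b c).transpose * N).trace := by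
  rw [trace_transpose_mul_eq_sum, ← Fintype.sum_prod_type'
    (f := fun i j => upperOfEntries b c i j * N i j)]
  rw [← Finset.sum_subset (Finset.subset_univ
    (Finset.univ.filter fun x : Fin n × Fin n => EntryRel b x.1 x.2))]
  · rw [Finset.sum_subtype (p := fun x : Fin n × Fin n => EntryRel b x.1 x.2) _ (by simp)]
    refine Finset.sum_congr rfl fun i _ => ?_
    rw [upperOfEntries, dif_pos i.2]
  · intro x _ hx
    have : ¬ EntryRel b x.1 x.2 := by simpa using hx
    rw [upperOfEntries, dif_neg this, zero_mul]

/-- Symmetrization is self-adjoint for the trace form, so it can be moved from the tangent vector to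
the coefficients. -/
theorem trace_upperOfEntries_mul {L : Type*} [Field L] {n : ℕ} {b : Bool}
    (A G : Matrix (Fin n) (Fin n) L) :
    (A.transpose * (G + transposeSign L b • G.transpose)).trace =
      ((A + transposeSign L b • A.transpose).transpose * G).trace := by
  have : (A.transpose * G.transpose).trace = (A * G).trace := by
    rw [← Matrix.transpose_mul, Matrix.trace_transpose, Matrix.trace_mul_comm]
  rw [Matrix.mul_add, Matrix.transpose_add, Matrix.transpose_smul, Matrix.transpose_transpose,
    Matrix.add_mul, Matrix.trace_add, Matrix.trace_add, Matrix.mul_smul, Matrix.smul_mul,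
    Matrix.trace_smul, Matrix.trace_smul, this]

/-- The differentials of the entries in `S` of a chart of the symmetric or alternating matrices of
bounded rank are independent exactly when no nonzero conormal vector is supported on `S`. -/
theorem symOrAlt_tangent_independent_iff {L : Type*} [Field L] {n d r : ℕ} {b : Bool}
    (hb : b = false → (2 : L) ≠ 0) (e : Fin n ≃ Fin d ⊕ Fin r) (S : Set (EntryIndex b n))
    [Fintype S] {C : Matrix (Fin d) (Fin d) L} (hCs : IsSymOrAlt b C) (hC : C.det ≠ 0)
    (P : Matrix (Fin r) (Fin d) L) :
    (∀ c : S → L, (∀ C' : Matrix (Fin d) (Fin d) L, IsSymOrAlt b C' →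
      ∀ P' : Matrix (Fin r) (Fin d) L,
        ∑ i : S, c i * chartTangent e e C P P C' P' P' i.1.1.1 i.1.1.2 = 0) → c = 0) ↔
      SymOrAltSupportInjective b S (coframe e P) := by
  -- The tangent vector is the (anti)symmetrization of a one-sided tangent vector, the kind treated
  -- by `forall_trace_tangent_eq_zero_iff`.
  have htang (W P') : chartTangent e e C P P (W + transposeSign L b • W.transpose) P' P' =
      (tailBlock e P' * C * (frame e P).transpose + frame e P * W * (frame e P).transpose) +
      transposeSign L b • (tailBlock e P' * C * (frame e P).transpose +
        frame e P * W * (frame e P).transpose).transpose := by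
    have h1 : (tailBlock e P' * C * (frame e P).transpose).transpose =
        transposeSign L b • (frame e P * C * (tailBlock e P').transpose) := by
      simp only [Matrix.transpose_mul, Matrix.transpose_transpose, hCs.transpose_eq,
        Matrix.smul_mul, Matrix.mul_smul, Matrix.mul_assoc]
    rw [Matrix.transpose_add, h1, smul_add, smul_smul, transposeSign_mul_self, one_smul]
    simp only [chartTangent, Matrix.mul_add, Matrix.add_mul, Matrix.mul_smul, Matrix.smul_mul,
      Matrix.transpose_mul, Matrix.transpose_transpose, Matrix.mul_assoc]
    abel
  have hH := forall_coefficients_subset_iff S {N : EntryIndex b n → L | ∃ C', IsSymOrAlt b C' ∧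
    ∃ P', N = fun i => chartTangent e e C P P C' P' P' i.1.1 i.1.2}
  have hcond₁ (c : S → L) : (∀ N ∈ {N : EntryIndex b n → L | ∃ C', IsSymOrAlt b C' ∧
        ∃ P', N = fun i => chartTangent e e C P P C' P' P' i.1.1 i.1.2}, ∑ i : S, c i * N i = 0) ↔
      ∀ C', IsSymOrAlt b C' → ∀ P',
        ∑ i : S, c i * chartTangent e e C P P C' P' P' i.1.1.1 i.1.1.2 = 0 :=
    ⟨fun h C' hC' P' => h _ ⟨C', hC', P', rfl⟩,
      by rintro h _ ⟨C', hC', P', rfl⟩; exact h C' hC' P'⟩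
  have hcond₂ (c : EntryIndex b n → L) : (∀ N ∈ {N : EntryIndex b n → L | ∃ C', IsSymOrAlt b C' ∧
        ∃ P', N = fun i => chartTangent e e C P P C' P' P' i.1.1 i.1.2}, ∑ i, c i * N i = 0) ↔
      ∀ C', IsSymOrAlt b C' → ∀ P',
        ∑ i, c i * chartTangent e e C P P C' P' P' i.1.1 i.1.2 = 0 :=
    ⟨fun h C' hC' P' => h _ ⟨C', hC', P', rfl⟩,
      by rintro h _ ⟨C', hC', P', rfl⟩; exact h C' hC' P'⟩
  simp only [hcond₁, hcond₂] at hH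
  rw [hH]
  let full (c : EntryIndex b n → L) : Matrix (Fin n) (Fin n) L :=
    upperOfEntries b c + transposeSign L b • (upperOfEntries b c).transpose
  have hfa (c) (i : EntryIndex b n) :
      full c i.1.1 i.1.2 = if i.1.1 = i.1.2 then 2 * c i else c i :=
    upperOfEntries_add_transpose_apply c i
  have hfull (c) : IsSymOrAlt b (full c) := isSymOrAlt_add_transpose _
  have hM (c : EntryIndex b n → L) :
      (∀ C', IsSymOrAlt b C' → ∀ P', ∑ i, c i * chartTangent e e C P P C' P' P' i.1.1 i.1.2 = 0) ↔
        full c * frame e P = 0 := by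
    rw [← forall_trace_tangent_eq_zero_iff e P (frame e P) hC]
    constructor
    · intro h W P'
      rw [← trace_upperOfEntries_mul, ← htang, ← sum_entries_eq_trace]
      exact h _ (isSymOrAlt_add_transpose W) P'
    · intro h C' hC' P'
      obtain ⟨W, rfl⟩ := hC'.exists_eq_add_transpose hb
      rw [sum_entries_eq_trace, htang, trace_upperOfEntries_mul]
      exact h W P'
  constructor
  · intro h B hBs hB
    let M := coframe e P * B * (coframe e P).transpose
    have hMs : IsSymOrAlt b M := hBs.mul_mul_transpose _
    -- Passing from `c` to `full c` doubles the diagonal entries, so these are halved beforehand.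
    -- Diagonal indices occur only in the symmetric case, where two is invertible.
    let c : EntryIndex b n → L := fun i =>
      if i.1.1 = i.1.2 then 2⁻¹ * M i.1.1 i.1.2 else M i.1.1 i.1.2
    have hc : full c = M := by
      refine (hfull c).eq_of_forall_entries hMs fun i => ?_
      rw [hfa]
      simp only [c]
      split_ifs with hi
      · have hrel : EntryRel b i.1.1 i.1.1 := by
          have := i.2
          rwa [← hi] at this
        rw [mul_inv_cancel_left₀ (hb hrel.eq_false)]
      · rfl
    have h0 := h c (fun i hi => by
      have : M i.1.1 i.1.2 = 0 := hB i hi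
      simp only [c, this, mul_zero, ite_self]) 
      ((hM c).2 (by rw [hc]; exact coframe_mul_mul_coframe_mul_frame e e P P B))
    have hM0 : M = 0 := by
      rw [← hc, h0]
      refine (hfull 0).eq_of_forall_entries (b := b) ⟨by simp, by simp⟩ fun i => ?_
      rw [hfa]
      simp
    rw [← coframe_mul_mul_submatrix e e P P B]
    change M.submatrix _ _ = 0
    rw [hM0]
    rfl
  · intro h c hc hN
    have h1 := (hM c).1 hN
    have h2 : (frame e P).transpose * full c = 0 := by
      rw [← Matrix.transpose_inj, Matrix.transpose_mul, Matrix.transpose_transpose,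
        (hfull c).transpose_eq, Matrix.smul_mul, h1, smul_zero, Matrix.transpose_zero]
    have h3 := eq_coframe_mul_mul_coframe e e P P _ h2 h1
    have h4 := h _ ((hfull c).submatrix _) fun i hi => by
      rw [← h3, hfa, hc i hi]
      simp
    rw [h4, Matrix.mul_zero, Matrix.zero_mul] at h3
    ext i
    have h5 := hfa c i
    rw [h3] at h5
    split_ifs at h5 with hi
    · have hrel : EntryRel b i.1.1 i.1.1 := by
        have := i.2
        rwa [← hi] at this
      simpa [hb hrel.eq_false] using h5.symm
    · exact h5.symm


/-! ### Derivatives of the charts -/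

section ChartDerivative

variable {k R L : Type*} [CommRing k] [CommRing R] [Field L] [Algebra k R] [Algebra R L]
  [Algebra k L] [IsScalarTower k R L]

theorem matrix_mul_map_derivation {ι κ σ : Type*} [Fintype κ] (D : Derivation k R L)
    (A : Matrix ι κ R) (B : Matrix κ σ R) :
    (A * B).map D = A.map D * B.map (algebraMap R L) + A.map (algebraMap R L) * B.map D := by
  ext i j
  simp only [Matrix.map_apply, Matrix.mul_apply, Matrix.add_apply, map_sum, Derivation.leibniz,
    Algebra.smul_def, ← Finset.sum_add_distrib]
  exact Finset.sum_congr rfl fun x _ => by ring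

theorem frame_map_derivation {ι δ ρ : Type*} [DecidableEq δ] (D : Derivation k R L)
    (e : ι ≃ δ ⊕ ρ) (P : Matrix ρ δ R) : (frame e P).map D = tailBlock e (P.map D) := by
  ext i j
  rcases h : e i with a | a
  · by_cases haj : a = j <;> simp [frame, tailBlock, h, haj]
  · simp [frame, tailBlock, h]

theorem chart_map_derivation {ι κ δ ρ ρ' : Type*} [Fintype δ] [DecidableEq δ] [DecidableEq ρ]
    [DecidableEq ρ'] (D : Derivation k R L)
    (e : ι ≃ δ ⊕ ρ) (e' : κ ≃ δ ⊕ ρ') (C : Matrix δ δ R) (P : Matrix ρ δ R) (Q : Matrix ρ' δ R) :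
    (frame e P * C * (frame e' Q).transpose).map D =
      chartTangent e e' (C.map (algebraMap R L)) (P.map (algebraMap R L)) (Q.map (algebraMap R L))
        (C.map D) (P.map D) (Q.map D) := by
  rw [matrix_mul_map_derivation, matrix_mul_map_derivation, frame_map_derivation,
    Matrix.transpose_map, Matrix.transpose_map, frame_map_derivation, Matrix.map_mul, frame_map,
    frame_map, Matrix.add_mul]
  rfl

theorem ofEntries_map_derivation {d : ℕ} {b : Bool} (D : Derivation k R L)
    (c : EntryIndex b d → R) : (ofEntries b c).map D = ofEntries b (fun t => D (c t)) := by
  ext i j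
  simp only [Matrix.map_apply, ofEntries]
  split_ifs
  · rfl
  · cases b <;> simp [transposeSign]
  · simp

end ChartDerivative

/-! ### Ideals and fields of the charts -/

/-- The hypothesis `h₁` puts the image of the parametrization inside `V`, and `h₂` says that it is
dense there. A polynomial vanishing on the image pulls back to one that vanishes at all points over
an infinite field, hence to zero. -/
theorem vanishingIdeal_eq_ker_aeval {k K E T : Type*} [Field k] [Field K] [Algebra k K] [Infinite K]
    {V : Set (E → K)} {φ : E → MvPolynomial T k}
    (h₁ : ∀ t : T → K, (fun e => MvPolynomial.aeval t (φ e)) ∈ V)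
    (h₂ : ∀ f : MvPolynomial E k, (∀ t : T → K,
      MvPolynomial.aeval (fun e => MvPolynomial.aeval t (φ e)) f = 0) →
        ∀ x ∈ V, MvPolynomial.aeval x f = 0) :
    MvPolynomial.vanishingIdeal k V = RingHom.ker (MvPolynomial.aeval φ).toRingHom := by
  have hcomp (t : T → K) (f : MvPolynomial E k) : MvPolynomial.aeval t (MvPolynomial.aeval φ f) =
      MvPolynomial.aeval (fun e => MvPolynomial.aeval t (φ e)) f :=
    MvPolynomial.comp_aeval_apply φ (MvPolynomial.aeval t) f
  ext f
  rw [MvPolynomial.mem_vanishingIdeal_iff, RingHom.mem_ker]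
  constructor
  · intro h
    have hmap : MvPolynomial.map (algebraMap k K) (MvPolynomial.aeval φ f) = 0 := by
      refine MvPolynomial.funext fun t => ?_
      rw [map_zero, MvPolynomial.eval_map, ← MvPolynomial.aeval_def, hcomp]
      exact h _ (h₁ t)
    exact MvPolynomial.map_injective _ (algebraMap k K).injective (hmap.trans (map_zero _).symm)
  · intro h
    refine h₂ f fun t => ?_
    rw [← hcomp, show MvPolynomial.aeval φ f = 0 from h, map_zero]

theorem intermediateField_eq_top_of_forall_X_mem {k L T : Type*} [Field k] [Field L] [Algebra k L]
    [Algebra (MvPolynomial T k) L] [IsScalarTower k (MvPolynomial T k) L]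
    [IsFractionRing (MvPolynomial T k) L] (F : IntermediateField k L)
    (h : ∀ t, algebraMap (MvPolynomial T k) L (MvPolynomial.X t) ∈ F) : F = ⊤ := by
  have hpoly (f : MvPolynomial T k) : algebraMap (MvPolynomial T k) L f ∈ F := by
    induction f using MvPolynomial.induction_on with
    | C a =>
      rw [← MvPolynomial.algebraMap_eq, ← IsScalarTower.algebraMap_apply]
      exact F.algebraMap_mem a
    | add p q hp hq => rw [map_add]; exact add_mem hp hq
    | mul_X p t hp => rw [map_mul]; exact mul_mem hp (h t)
  rw [eq_top_iff]
  intro x _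
  obtain ⟨a, b, -, rfl⟩ := IsFractionRing.div_surjective (A := MvPolynomial T k) x
  exact div_mem (hpoly a) (hpoly b)

/-- Since `P = D * C⁻¹`, and the inverse can be computed inside `F`, the entries of `P` stay in `F`.
-/
theorem mem_of_mul_eq {k L ρ δ : Type*} [Field k] [Field L] [Algebra k L] [Fintype δ]
    [DecidableEq δ] (F : IntermediateField k L) {P D : Matrix ρ δ L} {C : Matrix δ δ L}
    (hC : C.det ≠ 0) (hCF : ∀ i j, C i j ∈ F) (hDF : ∀ i j, D i j ∈ F) (h : P * C = D) (i : ρ)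
    (j : δ) : P i j ∈ F := by
  let C₀ : Matrix δ δ F := Matrix.of fun i j => ⟨C i j, hCF i j⟩
  let D₀ : Matrix ρ δ F := Matrix.of fun i j => ⟨D i j, hDF i j⟩
  have hC₀ : C₀.map (algebraMap F L) = C := rfl
  have hD₀ : D₀.map (algebraMap F L) = D := rfl
  have hdet : C₀.det ≠ 0 := by
    intro h0
    rw [← hC₀, ← RingHom.mapMatrix_apply, ← RingHom.map_det, h0, map_zero] at hC
    exact hC rfl
  have hP : P = (D₀ * C₀⁻¹).map (algebraMap F L) := by
    have h1 : (D₀ * C₀⁻¹).map (algebraMap F L) * C = D := by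
      rw [← hC₀, ← Matrix.map_mul, Matrix.mul_assoc, Matrix.nonsing_inv_mul _ hdet.isUnit,
        Matrix.mul_one, hD₀]
    have h2 : ∀ Z : Matrix ρ δ L, Z = Z * C * C⁻¹ := fun Z => by
      rw [Matrix.mul_assoc, Matrix.mul_nonsing_inv _ hC.isUnit, Matrix.mul_one]
    rw [h2 P, h, ← h1, ← h2]
  rw [hP]
  exact ((D₀ * C₀⁻¹) i j).2

theorem chart_submatrix_inl_inl {R ι κ δ ρ ρ' : Type*} [CommRing R] [Fintype δ] [DecidableEq δ]
    (e : ι ≃ δ ⊕ ρ) (e' : κ ≃ δ ⊕ ρ') (C : Matrix δ δ R) (P : Matrix ρ δ R) (Q : Matrix ρ' δ R) :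
    (frame e P * C * (frame e' Q).transpose).submatrix (e.symm ∘ Sum.inl) (e'.symm ∘ Sum.inl) =
      C := by
  have h1 : (frame e P).submatrix (e.symm ∘ Sum.inl) id = 1 := by
    ext i j; simp [frame]
  have h2 : (frame e' Q).transpose.submatrix id (e'.symm ∘ Sum.inl) = 1 := by
    ext i j; simp [frame, Matrix.one_apply, eq_comm]
  rw [Matrix.submatrix_mul _ _ _ id _ Function.bijective_id,
    Matrix.submatrix_mul _ _ _ id _ Function.bijective_id, h1, h2]
  simp

theorem chart_submatrix_inr_inl {R ι κ δ ρ ρ' : Type*} [CommRing R] [Fintype δ] [DecidableEq δ]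
    (e : ι ≃ δ ⊕ ρ) (e' : κ ≃ δ ⊕ ρ') (C : Matrix δ δ R) (P : Matrix ρ δ R) (Q : Matrix ρ' δ R) :
    (frame e P * C * (frame e' Q).transpose).submatrix (e.symm ∘ Sum.inr) (e'.symm ∘ Sum.inl) =
      P * C := by
  have h1 : (frame e P).submatrix (e.symm ∘ Sum.inr) id = P := by
    ext i j; simp [frame]
  have h2 : (frame e' Q).transpose.submatrix id (e'.symm ∘ Sum.inl) = 1 := by
    ext i j; simp [frame, Matrix.one_apply, eq_comm]
  rw [Matrix.submatrix_mul _ _ _ id _ Function.bijective_id,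
    Matrix.submatrix_mul _ _ _ id _ Function.bijective_id, h1, h2]
  simp

theorem chart_transpose {R ι κ δ ρ ρ' : Type*} [CommRing R] [Fintype δ] [DecidableEq δ]
    (e : ι ≃ δ ⊕ ρ) (e' : κ ≃ δ ⊕ ρ') (C : Matrix δ δ R) (P : Matrix ρ δ R) (Q : Matrix ρ' δ R) :
    (frame e P * C * (frame e' Q).transpose).transpose =
      frame e' Q * C.transpose * (frame e P).transpose := by
  simp only [Matrix.transpose_mul, Matrix.transpose_transpose, Matrix.mul_assoc]

/-- A field that contains the entries of a chart contains its parameters. -/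
theorem parameters_mem_of_chart_mem {k L ι κ δ ρ ρ' : Type*} [Field k] [Field L] [Algebra k L]
    [Fintype δ] [DecidableEq δ] (F : IntermediateField k L) (e : ι ≃ δ ⊕ ρ) (e' : κ ≃ δ ⊕ ρ')
    {C : Matrix δ δ L} (hC : C.det ≠ 0) {P : Matrix ρ δ L} {Q : Matrix ρ' δ L}
    (h : ∀ i j, (frame e P * C * (frame e' Q).transpose) i j ∈ F) :
    (∀ i j, C i j ∈ F) ∧ (∀ i j, P i j ∈ F) ∧ ∀ i j, Q i j ∈ F := by
  have hCF : ∀ i j, C i j ∈ F := by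
    intro i j
    rw [← chart_submatrix_inl_inl e e' C P Q]
    exact h _ _
  -- The upper left block of the chart is `C` and the lower left block is `P * C`; the lower left
  -- block of the transposed chart is `Q * Cᵀ`.
  refine ⟨hCF, mem_of_mul_eq F hC hCF (fun i j => ?_) (chart_submatrix_inr_inl e e' C P Q).symm,
    mem_of_mul_eq F (C := C.transpose) (by rwa [Matrix.det_transpose]) (fun i j => hCF j i)
      (fun i j => ?_) (chart_submatrix_inr_inl e' e C.transpose Q P).symm⟩
  · exact h _ _
  · rw [← chart_transpose]
    exact h _ _

theorem charP_fractionRing_mvPolynomial (k T : Type*) [Field k] (p : ℕ) [CharP k p] :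
    CharP (FractionRing (MvPolynomial T k)) p :=
  charP_of_injective_algebraMap (algebraMap k (FractionRing (MvPolynomial T k))).injective p

theorem algebraicIndependent_algebraMap_X (k T : Type*) [Field k] :
    AlgebraicIndependent k fun t : T =>
      algebraMap _ (FractionRing (MvPolynomial T k)) (MvPolynomial.X t : MvPolynomial T k) :=
  (MvPolynomial.algebraicIndependent_X T k).map'
    (f := IsScalarTower.toAlgHom k (MvPolynomial T k) (FractionRing (MvPolynomial T k)))
    (IsFractionRing.injective _ _)


/-! ### The variety of matrices of bounded rank -/

theorem rank_mul_mul_le {K ι κ : Type*} [Field K] [Fintype κ] {d : ℕ} (X : Matrix ι (Fin d) K)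
    (C : Matrix (Fin d) (Fin d) K) (Y : Matrix (Fin d) κ K) [Fintype ι] : (X * C * Y).rank ≤ d := by
  refine (Matrix.rank_mul_le_left _ _).trans ((Matrix.rank_mul_le_left _ _).trans ?_)
  simpa using X.rank_le_card_width

/-- This is birationality of the chart: its parameters are rational functions of its entries, and by
`hX` every variable is among the parameters. -/
theorem adjoin_chart_eq_top {k T δ ρ ρ' : Type*} [Field k] [Fintype δ] [DecidableEq δ]
    [DecidableEq ρ] [DecidableEq ρ'] {m n : ℕ} (e : Fin m ≃ δ ⊕ ρ) (e' : Fin n ≃ δ ⊕ ρ')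
    {C : Matrix δ δ (MvPolynomial T k)}
    {P : Matrix ρ δ (MvPolynomial T k)} {Q : Matrix ρ' δ (MvPolynomial T k)} (hC : C.det ≠ 0)
    (hX : ∀ t, (∃ i j, C i j = MvPolynomial.X t) ∨ (∃ i j, P i j = MvPolynomial.X t) ∨
      ∃ i j, Q i j = MvPolynomial.X t) :
    IntermediateField.adjoin k (Set.range fun x : Fin m × Fin n =>
      algebraMap _ (FractionRing (MvPolynomial T k))
        ((frame e P * C * (frame e' Q).transpose) x.1 x.2)) = ⊤ := by
  set F := IntermediateField.adjoin k (Set.range fun x : Fin m × Fin n =>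
      algebraMap _ (FractionRing (MvPolynomial T k))
        ((frame e P * C * (frame e' Q).transpose) x.1 x.2))
  let a := algebraMap (MvPolynomial T k) (FractionRing (MvPolynomial T k))
  have hCa : (C.map a).det ≠ 0 := by
    rw [← RingHom.mapMatrix_apply, ← RingHom.map_det]
    exact (map_ne_zero_iff _ (IsFractionRing.injective _ _)).2 hC
  have hmap : (frame e P * C * (frame e' Q).transpose).map a =
      frame e (P.map a) * C.map a * (frame e' (Q.map a)).transpose := by
    rw [Matrix.map_mul, Matrix.map_mul, Matrix.transpose_map, frame_map, frame_map]
  obtain ⟨h1, h2, h3⟩ := parameters_mem_of_chart_mem F e e' hCa (P := P.map a) (Q := Q.map a) (by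
    intro i j
    rw [← hmap]
    exact IntermediateField.subset_adjoin _ _ ⟨(i, j), rfl⟩)
  refine intermediateField_eq_top_of_forall_X_mem (T := T) F fun t => ?_
  rcases hX t with ⟨i, j, h⟩ | ⟨i, j, h⟩ | ⟨i, j, h⟩ <;> rw [← h]
  exacts [h1 i j, h2 i j, h3 i j]

section General

variable {R A : Type*} [CommRing R] [CommRing A] {m n d s r : ℕ}

/-- The parameters of the chart of the variety of matrices of rank at most `d`. -/
abbrev ChartIndex (d s r : ℕ) : Type := (Fin d × Fin d) ⊕ ((Fin s × Fin d) ⊕ (Fin r × Fin d))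

/-- The chart of the variety of matrices of rank at most `d`. -/
def chart (e : Fin m ≃ Fin d ⊕ Fin s) (e' : Fin n ≃ Fin d ⊕ Fin r) (t : ChartIndex d s r → R) :
    Matrix (Fin m) (Fin n) R :=
  frame e (Matrix.of fun i j => t (.inr (.inl (i, j)))) * Matrix.of (fun i j => t (.inl (i, j))) *
    (frame e' (Matrix.of fun i j => t (.inr (.inr (i, j))))).transpose

theorem chart_map (e : Fin m ≃ Fin d ⊕ Fin s) (e' : Fin n ≃ Fin d ⊕ Fin r)
    (t : ChartIndex d s r → R) (f : R →+* A) :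
    (chart e e' t).map f = chart e e' (fun x => f (t x)) := by
  rw [chart, Matrix.map_mul, Matrix.map_mul, Matrix.transpose_map, frame_map, frame_map]
  rfl

/-- The upper blocks `G` and `H` are factored out of `X` and `Y` and absorbed in the middle factor,
which becomes `G * C * Hᵀ`. -/
theorem exists_chart_eq {K : Type*} [Field K] (e : Fin m ≃ Fin d ⊕ Fin s)
    (e' : Fin n ≃ Fin d ⊕ Fin r) {X : Matrix (Fin m) (Fin d) K} {Y : Matrix (Fin n) (Fin d) K}
    (C : Matrix (Fin d) (Fin d) K) (hX : (X.submatrix (e.symm ∘ Sum.inl) id).det ≠ 0)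
    (hY : (Y.submatrix (e'.symm ∘ Sum.inl) id).det ≠ 0) :
    ∃ t : ChartIndex d s r → K, chart e e' t = X * C * Y.transpose := by
  have h1 := eq_frame_mul e X hX.isUnit
  have h2 := eq_frame_mul e' Y hY.isUnit
  set G := X.submatrix (e.symm ∘ Sum.inl) id
  set H := Y.submatrix (e'.symm ∘ Sum.inl) id
  set P := X.submatrix (e.symm ∘ Sum.inr) id * G⁻¹
  set Q := Y.submatrix (e'.symm ∘ Sum.inr) id * H⁻¹
  refine ⟨Sum.elim (fun x => (G * C * H.transpose) x.1 x.2)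
    (Sum.elim (fun x => P x.1 x.2) (fun x => Q x.1 x.2)), ?_⟩
  rw [h1, h2, Matrix.transpose_mul]
  change frame e P * (G * C * H.transpose) * (frame e' Q).transpose = _
  simp only [Matrix.mul_assoc]

theorem det_generic_ne_zero (k : Type*) [Field k] {T : Type*} {d : ℕ} {ξ : Fin d × Fin d → T}
    (hξ : Function.Injective ξ) :
    (Matrix.of fun i j => (MvPolynomial.X (ξ (i, j)) : MvPolynomial T k) :
      Matrix (Fin d) (Fin d) (MvPolynomial T k)).det ≠ 0 := by
  intro h
  have := congrArg (MvPolynomial.aeval (Function.extend ξ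
    (fun x => (1 : Matrix (Fin d) (Fin d) k) x.1 x.2) 0)) h
  rw [map_zero, AlgHom.map_det] at this
  have h1 : (MvPolynomial.aeval (Function.extend ξ
      (fun x => (1 : Matrix (Fin d) (Fin d) k) x.1 x.2) 0)).mapMatrix
      (Matrix.of fun i j => (MvPolynomial.X (ξ (i, j)) : MvPolynomial T k)) = 1 := by
    ext i j
    simp [hξ.extend_apply]
  rw [h1, Matrix.det_one] at this
  exact one_ne_zero this

variable (k : Type*) [Field k]

/-- Every matrix of rank at most `d` is a product `X * 1 * Yᵀ`; such products with invertible upper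
blocks lie in the chart, and by `aeval_eq_zero_of_forall_det_ne_zero` a polynomial vanishing on
these vanishes on all of them. -/
theorem matrixIdeal_rankLocus (e : Fin m ≃ Fin d ⊕ Fin s) (e' : Fin n ≃ Fin d ⊕ Fin r) :
    matrixIdeal k (rankLocus (AlgebraicClosure k) m n d) = RingHom.ker (MvPolynomial.aeval
      (fun x : Fin m × Fin n => chart e e'
        (fun t => (MvPolynomial.X t : MvPolynomial (ChartIndex d s r) k)) x.1 x.2)).toRingHom := by
  have heval (t : ChartIndex d s r → AlgebraicClosure k) (i j) :
      MvPolynomial.aeval t (chart e e' (fun t => (MvPolynomial.X t : MvPolynomial _ k)) i j) =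
        chart e e' t i j := by
    have := congrFun (congrFun (chart_map e e' (fun t => (MvPolynomial.X t : MvPolynomial _ k))
      (MvPolynomial.aeval t).toRingHom) i) j
    simpa using this
  refine vanishingIdeal_eq_ker_aeval (fun t => ⟨chart e e' t, rank_mul_mul_le _ _ _, ?_⟩) ?_
  · funext x
    exact (heval t _ _).symm
  · rintro f hf _ ⟨B, hB, rfl⟩
    obtain ⟨X, L, hXL⟩ := exists_mul_mul_eq_of_rank_le B hB
    have hB' : B = X * (1 : Matrix (Fin d) (Fin d) (AlgebraicClosure k)) *
        (L * B).transpose.transpose := by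
      rw [Matrix.transpose_transpose, Matrix.mul_one, ← Matrix.mul_assoc, hXL]
    rw [hB']
    refine aeval_eq_zero_of_forall_det_ne_zero e e' f _ _ _ fun z h1 h2 => ?_
    obtain ⟨t, ht⟩ := exists_chart_eq e e' 1 h1 h2
    rw [← ht, ← hf t]
    simp only [heval]

theorem tensorMatroid_dual_indep_iff_separablyAlgebraicallyIndependent (p : ℕ) [CharP k p]
    {F : Type*} [Field F] [CharP F p] (e : Fin m ≃ Fin d ⊕ Fin s) (e' : Fin n ≃ Fin d ⊕ Fin r) :
    ∃ _ : (matrixIdeal k (rankLocus (AlgebraicClosure k) m n d)).IsPrime,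
      ∀ (u : Fin m → Fin s → F) (v : Fin n → Fin r → F),
        JointlyTotallyGeneric u v → ∀ S : Set (Fin m × Fin n),
          (tensorMatroid u v).dual.Indep S ↔
            SeparablyAlgebraicallyIndependent k (fun e : S =>
              coordinateFunction k (rankLocus (AlgebraicClosure k) m n d) e.1) := by
  classical
  have hI := matrixIdeal_rankLocus k e e'
  have hprime := matrixIdeal_isPrime_of_eq_ker hI
  refine ⟨hprime, fun u v huv S => ?_⟩
  have hdet := det_generic_ne_zero k (T := ChartIndex d s r) (Sum.inl_injective)
  obtain ⟨E, hE⟩ := exists_algEquiv_functionField hI (adjoin_chart_eq_top e e' hdet (by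
    rintro (⟨i, j⟩ | ⟨i, j⟩ | ⟨i, j⟩)
    exacts [.inl ⟨i, j, rfl⟩, .inr (.inl ⟨i, j, rfl⟩), .inr (.inr ⟨i, j, rfl⟩)]))
  rw [separablyAlgebraicallyIndependent_iff_of_algEquiv E _ _ (fun i : S => hE i.1)]
  have := charP_fractionRing_mvPolynomial k (ChartIndex d s r) p
  rw [tensorMatroid_dual_indep_iff, supportInjective_coframe_iff p e e' S huv (K₀ := k)
    (K := FractionRing (MvPolynomial (ChartIndex d s r) k))
    (P := (Matrix.of fun i j => (MvPolynomial.X (.inr (.inl (i, j))) :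
      MvPolynomial (ChartIndex d s r) k)).map (algebraMap _ _))
    (Q := (Matrix.of fun i j => (MvPolynomial.X (.inr (.inr (i, j))) :
      MvPolynomial (ChartIndex d s r) k)).map (algebraMap _ _)) (by
    have hX := (algebraicIndependent_algebraMap_X k (ChartIndex d s r)).comp Sum.inr
      Sum.inr_injective
    rw [← Sum.elim_comp_inl_inr (_ ∘ _)] at hX
    exact hX),
    ← tangent_independent_iff e e' S (C := (Matrix.of fun i j => (MvPolynomial.X (.inl (i, j)) :
      MvPolynomial (ChartIndex d s r) k)).map (algebraMap _ _)) (by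
        rw [← RingHom.mapMatrix_apply, ← RingHom.map_det]
        exact (map_ne_zero_iff _ (IsFractionRing.injective _ _)).2 hdet)]
  -- Differentiating the chart in the direction `w` gives the tangent vector whose components are
  -- those of `w`, so directions `w` and triples `(C', P', Q')` correspond.
  have hD (w : ChartIndex d s r → FractionRing (MvPolynomial (ChartIndex d s r) k)) (i j) :
      MvPolynomial.mkDerivation k w (chart e e'
        (fun t => (MvPolynomial.X t : MvPolynomial (ChartIndex d s r) k)) i j) = _ :=
    congrFun (congrFun (chart_map_derivation (MvPolynomial.mkDerivation k w) e e' _ _ _) i) j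
  refine forall_congr' fun c => imp_congr_left ⟨fun h w => ?_, fun h C' P' Q' => ?_⟩
  · simp only [hD]
    exact h _ _ _
  · rw [← h (Sum.elim (fun x => C' x.1 x.2) (Sum.elim (fun x => P' x.1 x.2) (fun x => Q' x.1 x.2)))]
    refine Finset.sum_congr rfl fun i _ => ?_
    rw [hD]
    congr 3 <;> ext <;> simp

end General


/-! ### The varieties of symmetric and alternating matrices of bounded rank -/

section SymOrAltVariety

variable {R A : Type*} [CommRing R] [CommRing A] {n d r : ℕ} {b : Bool}

/-- The symmetric or alternating matrices of rank at most `d`. -/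
def symOrAltRankLocus (b : Bool) (K : Type*) [Field K] (n d : ℕ) : Set (Matrix (Fin n) (Fin n) K) :=
  {A | IsSymOrAlt b A ∧ A.rank ≤ d}

theorem symOrAltRankLocus_false (K : Type*) [Field K] (n d : ℕ) :
    symOrAltRankLocus false K n d = symRankLocus K n d := by
  ext A
  refine and_congr_left fun _ => ⟨fun h => ?_, fun h => ⟨?_, by simp⟩⟩
  · simpa [transposeSign, Matrix.IsSymm] using h.transpose_eq
  · simpa [transposeSign, Matrix.IsSymm] using h

theorem symOrAltRankLocus_true (K : Type*) [Field K] (n d : ℕ) :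
    symOrAltRankLocus true K n d = skewRankLocus K n d := by
  ext A
  constructor
  · rintro ⟨h, hA⟩
    exact ⟨by simpa [transposeSign] using h.transpose_eq, h.diag_eq_zero rfl, hA⟩
  · rintro ⟨h, h', hA⟩
    exact ⟨⟨by simpa [transposeSign] using h, fun _ => h'⟩, hA⟩

/-- The parameters of the chart of the variety of symmetric or alternating matrices of rank at most
`d`. -/
abbrev SymOrAltChartIndex (b : Bool) (d r : ℕ) : Type := EntryIndex b d ⊕ (Fin r × Fin d)

/-- The chart of the variety of symmetric or alternating matrices of rank at most `d`. -/
def symOrAltChart (e : Fin n ≃ Fin d ⊕ Fin r) (t : SymOrAltChartIndex b d r → R) :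
    Matrix (Fin n) (Fin n) R :=
  frame e (Matrix.of fun i j => t (.inr (i, j))) * ofEntries b (fun x => t (.inl x)) *
    (frame e (Matrix.of fun i j => t (.inr (i, j)))).transpose

theorem symOrAltChart_map (e : Fin n ≃ Fin d ⊕ Fin r) (t : SymOrAltChartIndex b d r → R)
    (f : R →+* A) : (symOrAltChart e t).map f = symOrAltChart e (fun x => f (t x)) := by
  rw [symOrAltChart, Matrix.map_mul, Matrix.map_mul, Matrix.transpose_map, frame_map, ofEntries_map]
  rfl

theorem exists_symOrAltChart_eq {K : Type*} [Field K] (e : Fin n ≃ Fin d ⊕ Fin r)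
    {X : Matrix (Fin n) (Fin d) K} {C : Matrix (Fin d) (Fin d) K} (hC : IsSymOrAlt b C)
    (hX : (X.submatrix (e.symm ∘ Sum.inl) id).det ≠ 0) :
    ∃ t : SymOrAltChartIndex b d r → K, symOrAltChart e t = X * C * X.transpose := by
  have h1 := eq_frame_mul e X hX.isUnit
  set G := X.submatrix (e.symm ∘ Sum.inl) id
  set P := X.submatrix (e.symm ∘ Sum.inr) id * G⁻¹
  have hG := (hC.mul_mul_transpose G).ofEntries_eq
  refine ⟨Sum.elim (fun x => (G * C * G.transpose) x.1.1 x.1.2) (fun x => P x.1 x.2), ?_⟩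
  rw [h1, Matrix.transpose_mul]
  change frame e P * ofEntries b (fun x => (G * C * G.transpose) x.1.1 x.1.2) *
    (frame e P).transpose = _
  rw [hG]
  simp only [Matrix.mul_assoc]

/-- The matrix `X * L` fixes `B` from the left and, by transposition, its transpose fixes `B` from
the right; hence `B = X * (L * B * Lᵀ) * Xᵀ`. -/
theorem IsSymOrAlt.exists_factorization {K : Type*} [Field K] {B : Matrix (Fin n) (Fin n) K}
    (hB : IsSymOrAlt b B) (h : B.rank ≤ d) : ∃ (X : Matrix (Fin n) (Fin d) K)
      (C : Matrix (Fin d) (Fin d) K), IsSymOrAlt b C ∧ B = X * C * X.transpose := by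
  obtain ⟨X, L, hXL⟩ := exists_mul_mul_eq_of_rank_le B h
  refine ⟨X, L * B * L.transpose, hB.mul_mul_transpose L, ?_⟩
  have h1 : B * (X * L).transpose = B := by
    have h2 := congrArg Matrix.transpose hXL
    rw [Matrix.transpose_mul, hB.transpose_eq, Matrix.smul_mul] at h2
    have h3 := congrArg (transposeSign K b • ·) h2
    simpa only [smul_smul, transposeSign_mul_self, one_smul] using h3
  calc B = X * L * B * (X * L).transpose := by rw [hXL, h1]
    _ = _ := by simp only [Matrix.transpose_mul, Matrix.mul_assoc]

/-- The generic determinant specializes to that of `M`. An invertible `M` of the given type must be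
supplied, and for alternating matrices this is what restricts the size to be even. -/
theorem det_ofEntries_X_ne_zero {k : Type*} [Field k] {T : Type*} {ξ : EntryIndex b d → T}
    (hξ : Function.Injective ξ) {M : Matrix (Fin d) (Fin d) k} (hM : IsSymOrAlt b M)
    (hdet : M.det ≠ 0) :
    (ofEntries b fun x => (MvPolynomial.X (ξ x) : MvPolynomial T k)).det ≠ 0 := by
  intro h
  let f : MvPolynomial T k →ₐ[k] k :=
    MvPolynomial.aeval (Function.extend ξ (fun x => M x.1.1 x.1.2) 0)
  have h1 : f.toRingHom.mapMatrix (ofEntries b fun x => (MvPolynomial.X (ξ x) : MvPolynomial T k)) =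
      M := by
    rw [RingHom.mapMatrix_apply, ofEntries_map, ← hM.ofEntries_eq]
    congr 1
    funext x
    simp [f, hξ.extend_apply]
  have h2 := congrArg f.toRingHom h
  rw [RingHom.map_det, h1, map_zero] at h2
  exact hdet h2

variable (k : Type*) [Field k]

theorem matrixIdeal_symOrAltRankLocus (e : Fin n ≃ Fin d ⊕ Fin r) :
    matrixIdeal k (symOrAltRankLocus b (AlgebraicClosure k) n d) =
      RingHom.ker (MvPolynomial.aeval (fun x : Fin n × Fin n => symOrAltChart e
        (fun t => (MvPolynomial.X t : MvPolynomial (SymOrAltChartIndex b d r) k))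
          x.1 x.2)).toRingHom := by
  have heval (t : SymOrAltChartIndex b d r → AlgebraicClosure k) (i j) :
      MvPolynomial.aeval t (symOrAltChart e (fun t => (MvPolynomial.X t : MvPolynomial _ k)) i j) =
        symOrAltChart e t i j := by
    have := congrFun (congrFun (symOrAltChart_map e
      (fun t => (MvPolynomial.X t : MvPolynomial _ k)) (MvPolynomial.aeval t).toRingHom) i) j
    simpa using this
  refine vanishingIdeal_eq_ker_aeval (fun t => ⟨symOrAltChart e t,
    ⟨(isSymOrAlt_ofEntries _).mul_mul_transpose _, rank_mul_mul_le _ _ _⟩, ?_⟩) ?_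
  · funext x
    exact (heval t _ _).symm
  · rintro f hf _ ⟨B, ⟨hB, hrank⟩, rfl⟩
    obtain ⟨X, C, hC, rfl⟩ := hB.exists_factorization hrank
    -- Both outer factors move along the same line while `C` stays fixed, so the product keeps its
    -- symmetry type and one determinant condition suffices.
    refine aeval_eq_zero_of_forall_det_ne_zero e e f _ _ _ fun z h1 _ => ?_
    obtain ⟨t, ht⟩ := exists_symOrAltChart_eq e hC h1
    rw [← ht, ← hf t]
    simp only [heval]

theorem dual_indep_iff_separablyAlgebraicallyIndependent_of_symOrAlt (p : ℕ) [CharP k p]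
    {F : Type*} [Field F] [CharP F p] (hb : b = false → (2 : k) ≠ 0)
    {M : Matrix (Fin d) (Fin d) k} (hM : IsSymOrAlt b M) (hMdet : M.det ≠ 0)
    (e : Fin n ≃ Fin d ⊕ Fin r) :
    ∃ _ : (matrixIdeal k (symOrAltRankLocus b (AlgebraicClosure k) n d)).IsPrime,
      ∀ v : Fin n → Fin r → F, TotallyGeneric v → ∀ S : Set (EntryIndex b n),
        (∀ B : Matrix (Fin r) (Fin r) F, IsSymOrAlt b B → (∀ e : EntryIndex b n, e ∉ S →
          (Matrix.of v * B * (Matrix.of v).transpose) e.1.1 e.1.2 = 0) →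
            Matrix.of v * B * (Matrix.of v).transpose = 0) ↔
          SeparablyAlgebraicallyIndependent k (fun e : S =>
            coordinateFunction k (symOrAltRankLocus b (AlgebraicClosure k) n d) e.1.1) := by
  classical
  have hI := matrixIdeal_symOrAltRankLocus (b := b) k e
  have hprime := matrixIdeal_isPrime_of_eq_ker hI
  refine ⟨hprime, fun v hv S => ?_⟩
  have hdet := det_ofEntries_X_ne_zero (T := SymOrAltChartIndex b d r) Sum.inl_injective hM hMdet
  obtain ⟨E, hE⟩ := exists_algEquiv_functionField hI (adjoin_chart_eq_top e e hdet (by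
    rintro (x | ⟨i, j⟩)
    exacts [.inl ⟨x.1.1, x.1.2, ofEntries_apply _ x⟩, .inr (.inl ⟨i, j, rfl⟩)]))
  rw [separablyAlgebraicallyIndependent_iff_of_algEquiv E _ _ (fun i : S => hE i.1.1)]
  have := charP_fractionRing_mvPolynomial k (SymOrAltChartIndex b d r) p
  rw [symOrAltSupportInjective_coframe_iff p e S hv (K₀ := k)
    (K := FractionRing (MvPolynomial (SymOrAltChartIndex b d r) k))
    (P := (Matrix.of fun i j => (MvPolynomial.X (.inr (i, j)) :
      MvPolynomial (SymOrAltChartIndex b d r) k)).map (algebraMap _ _))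
    ((algebraicIndependent_algebraMap_X k (SymOrAltChartIndex b d r)).comp Sum.inr
      Sum.inr_injective),
    ← symOrAlt_tangent_independent_iff (C := (ofEntries b fun x => (MvPolynomial.X (.inl x) :
      MvPolynomial (SymOrAltChartIndex b d r) k)).map (algebraMap _ _)) (by
        intro h
        rw [← map_ofNat (algebraMap k _)]
        exact (map_ne_zero_iff _ (algebraMap k _).injective).2 (hb h)) e S (by
        rw [ofEntries_map]
        exact isSymOrAlt_ofEntries _) (by
        rw [← RingHom.mapMatrix_apply, ← RingHom.map_det]
        exact (map_ne_zero_iff _ (IsFractionRing.injective _ _)).2 hdet)]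
  have hD (w : SymOrAltChartIndex b d r → FractionRing (MvPolynomial (SymOrAltChartIndex b d r) k))
      (i j) : MvPolynomial.mkDerivation k w (symOrAltChart e
        (fun t => (MvPolynomial.X t : MvPolynomial (SymOrAltChartIndex b d r) k)) i j) = _ :=
    congrFun (congrFun (chart_map_derivation (MvPolynomial.mkDerivation k w) e e _ _ _) i) j
  refine forall_congr' fun c => imp_congr_left ⟨fun h w => ?_, fun h C' hC' P' => ?_⟩
  · simp only [hD]
    refine h _ ?_ _
    rw [ofEntries_map_derivation]
    exact isSymOrAlt_ofEntries _
  · rw [← h (Sum.elim (fun x => C' x.1.1 x.1.2) (fun x => P' x.1 x.2))]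
    refine Finset.sum_congr rfl fun i _ => ?_
    rw [hD, ofEntries_map_derivation]
    congr 3
    · simp [hC'.ofEntries_eq]
    all_goals ext; simp

theorem exists_alternating_det_ne_zero (d : ℕ) :
    ∃ M : Matrix (Fin (2 * d)) (Fin (2 * d)) k, IsSymOrAlt true M ∧ M.det ≠ 0 := by
  let σ : Fin (2 * d) ≃ Fin d ⊕ Fin d := (finCongr (two_mul d)).trans finSumFinEquiv.symm
  have hJ : IsSymOrAlt true (Matrix.J (Fin d) k) := by
    refine ⟨by rw [Matrix.J_transpose]; simp [transposeSign], ?_⟩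
    rintro - (i | i) <;> simp [Matrix.J]
  refine ⟨(Matrix.J (Fin d) k).submatrix σ σ, hJ.submatrix σ, ?_⟩
  rw [Matrix.det_submatrix_equiv_self]
  exact (Matrix.isUnit_det_J (Fin d) k).ne_zero

end SymOrAltVariety

/-! ### Assembly of the three statements -/

theorem two_ne_zero_of_charP {K : Type*} [Field K] (p : ℕ) [CharP K p] (hp : p ≠ 2) :
    (2 : K) ≠ 0 := by
  intro h
  have h1 : p ∣ 2 := (CharP.cast_eq_zero_iff K p 2).1 (by exact_mod_cast h)
  rcases (Nat.dvd_prime Nat.prime_two).1 h1 with h2 | h2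
  · exact CharP.char_ne_one K p h2
  · exact hp h2

/-- The decomposition of the indices into the first `d` and the rest. -/
def headTailEquiv {n d : ℕ} (h : d ≤ n) : Fin n ≃ Fin d ⊕ Fin (n - d) :=
  (finCongr (by omega : n = d + (n - d))).trans finSumFinEquiv.symm

end LowRank

open LowRank in
theorem mainTheorem10 (p : ℕ) (k : Type*) [Field k] [CharP k p] (F : Type*) [Field F] [CharP F p] :
    (p ≠ 2 → ∀ n d : ℕ, d ≤ n →
      ∃ _ : (matrixIdeal k (symRankLocus (AlgebraicClosure k) n d)).IsPrime,
        ∀ v : Fin n → Fin (n - d) → F, TotallyGeneric v → ∀ S : Set (SymIndex n),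
          (symmetricPowerMatroid v).dual.Indep S ↔
            SeparablyAlgebraicallyIndependent k (fun e : S =>
              coordinateFunction k (symRankLocus (AlgebraicClosure k) n d) e.1.1)) ∧
    (∀ n d : ℕ, 2 * d ≤ n →
      ∃ _ : (matrixIdeal k (skewRankLocus (AlgebraicClosure k) n (2 * d))).IsPrime,
        ∀ v : Fin n → Fin (n - 2 * d) → F, TotallyGeneric v → ∀ S : Set (SkewIndex n),
          (wedgePowerMatroid v).dual.Indep S ↔
            SeparablyAlgebraicallyIndependent k (fun e : S =>
              coordinateFunction k (skewRankLocus (AlgebraicClosure k) n (2 * d)) e.1.1)) ∧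
    (∀ m n d : ℕ, d ≤ m → d ≤ n →
      ∃ _ : (matrixIdeal k (rankLocus (AlgebraicClosure k) m n d)).IsPrime,
        ∀ (u : Fin m → Fin (m - d) → F) (v : Fin n → Fin (n - d) → F),
          JointlyTotallyGeneric u v → ∀ S : Set (Fin m × Fin n),
            (tensorMatroid u v).dual.Indep S ↔
              SeparablyAlgebraicallyIndependent k (fun e : S =>
                coordinateFunction k (rankLocus (AlgebraicClosure k) m n d) e.1)) := by
  have hone (d : ℕ) : IsSymOrAlt false (1 : Matrix (Fin d) (Fin d) k) :=
    ⟨by simp [transposeSign], by simp⟩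
  refine ⟨fun hp n d hd => ?_, fun n d hd => ?_, fun m n d hm hn =>
    tensorMatroid_dual_indep_iff_separablyAlgebraicallyIndependent k p (headTailEquiv hm)
      (headTailEquiv hn)⟩
  · have h := dual_indep_iff_separablyAlgebraicallyIndependent_of_symOrAlt k p (F := F)
      (fun _ => two_ne_zero_of_charP p hp) (hone d) (by simp) (headTailEquiv hd)
    rw [symOrAltRankLocus_false] at h
    obtain ⟨hprime, h⟩ := h
    exact ⟨hprime, fun v hv S =>
      (symmetricPowerMatroid_dual_indep_iff (two_ne_zero_of_charP p hp) v S).trans (h v hv S)⟩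
  -- The standard symplectic matrix witnesses that a generic alternating matrix of even size is
  -- invertible; no condition on the characteristic arises, since `b = true`.
  · obtain ⟨M, hM, hdet⟩ := exists_alternating_det_ne_zero k d
    have h := dual_indep_iff_separablyAlgebraicallyIndependent_of_symOrAlt k p (F := F)
      (by simp) hM hdet (headTailEquiv hd)
    rw [symOrAltRankLocus_true] at h
    obtain ⟨hprime, h⟩ := h
    exact ⟨hprime, fun v hv S => (wedgePowerMatroid_dual_indep_iff v S).trans (h v hv S)⟩
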